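/- Let $(\overline M,\overline g)$ be an $(n+2)$-dimensional Lorentzian manifold with Levi-Civita connection $\overline\nabla$. Let $(M,g,S(TM))$ be a totally geodesic lightlike hypersurface (immersed) of $\overline M$: $g$ is the induced degenerate metric, its radical distribution $\mathrm{Rad}\,TM=\{v\in TM : g(v,\cdot)=0\}$ is spanned by a nowhere vanishing smooth vector field $\xi$, the screen distribution $S(TM)$ is a smooth distribution with $TM=S(TM)\oplus \mathrm{Rad}\,TM$, and $P:TM\to S(TM)$ is the corresponding projection. Let $N$ be the transversal vector field along $M$ with $\overline g(N,\xi)=1$ and $\overline g(N,N)=\overline g(N,W)=0$ for all $W\in S(TM)$. Put $\eta=\overline g(N,\cdot)$ and $X^\flat=g(X,\cdot)+\eta(X)\eta$ on $M$. Let $\nabla_XY=Q(\overline\nabla_XY)$ be the induced connection on $M$, where $Q$ is the projection onto $TM$ along $\mathrm{span}\{N\}$; totally geodesic means $\overline\nabla_XY=\nabla_XY$ for all vector fields $X,Y$ on $M$. An $\mathcal A^\nabla$-tensor is a smooth field $S$ of endomorphisms of $TM$ such that $PS=SP$, $g(SX,Y)=g(X,SY)$ for all $X,Y\in TM$, and $X^\flat(\nabla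 S(X,X))=0$ for all $X\in TM$, where $\nabla S(X,Y)=\nabla_X(SY)-S(\nabla_XY)$. It is called isotropic if $\nabla S(X,Y)\in\mathrm{Rad}\,TM$ for all $X,Y\in TM$. Let $S$ be an $\mathcal A^\nabla$-tensor on $(M,g,S(TM))$ with constant eigenfunctions: there are distinct real numbers $\lambda_0,\dots,\lambda_k$ which are, at every point of $M$, exactly the eigenvalues of $S$. Assume that the eigenspace distributions $D_\alpha=\ker(\lambda_\alpha I-S)$, $0\le\alpha\le k$, form an integrable almost product structure, i.e. every sum $D_{\alpha_1}\oplus\dots\oplus D_{\alpha_p}$ (with distinct indices) is integrable (its sections are closed under the Lie bracket). Then $S$ is an isotropic $\mathcal A^\nabla$-tensor. -/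

import Mathlib

open Bundle Set
open scoped Manifold ContDiff

noncomputable section

namespace LightlikeGeometry

/-! ### Vector fields and distributions

An `m`-dimensional manifold is modelled on `EuclideanSpace ℝ (Fin m)`; smooth means `C^∞`. -/

section Distributions

variable {m : ℕ} {M : Type*} [TopologicalSpace M] [ChartedSpace (EuclideanSpace ℝ (Fin m)) M]

/-- `X` is a smooth vector field on `M`, that is `X ∈ Γ(TM)`. -/
def IsSmoothField [IsManifold (𝓡 m) ∞ M] (X : Π x : M, TangentSpace (𝓡 m) x) : Prop :=
  ContMDiff (𝓡 m) (𝓡 m).tangent ∞ (fun x ↦ (⟨x, X x⟩ : TangentBundle (𝓡 m) M))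

/-- `X ∈ Γ(D)`: a smooth vector field with values in the distribution `D`. -/
def IsSectionOf [IsManifold (𝓡 m) ∞ M] (D : Π x : M, Submodule ℝ (TangentSpace (𝓡 m) x))
    (X : Π x : M, TangentSpace (𝓡 m) x) : Prop :=
  IsSmoothField X ∧ ∀ x, X x ∈ D x

/-- A distribution is smooth if it is spanned at each point by values of its smooth sections. -/
def IsSmoothDistribution [IsManifold (𝓡 m) ∞ M]
    (D : Π x : M, Submodule ℝ (TangentSpace (𝓡 m) x)) : Prop :=
  ∀ x, ∀ v ∈ D x, ∃ X : Π x : M, TangentSpace (𝓡 m) x, IsSectionOf D X ∧ X x = v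

/-- A distribution is integrable if `[X, Y] ∈ Γ(D)` for all `X, Y ∈ Γ(D)` (for smooth distributions
of locally constant rank this is the same as being tangent to a foliation, by Frobenius). -/
def IsIntegrable [IsManifold (𝓡 m) ∞ M]
    (D : Π x : M, Submodule ℝ (TangentSpace (𝓡 m) x)) : Prop :=
  ∀ X Y : Π x : M, TangentSpace (𝓡 m) x, IsSectionOf D X → IsSectionOf D Y →
    ∀ x, VectorField.mlieBracket (𝓡 m) X Y x ∈ D x

/-- The independent distributions `D 0, …, D k` form an integrable almost product structure: every
sum `D α₁ ⊕ ⋯ ⊕ D αₚ` of some of them is integrable. (Below, `D` is the family of all the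
eigendistributions of an endomorphism field, for distinct eigenvalues, so sums are direct.) -/
def IsIntegrableAlmostProduct [IsManifold (𝓡 m) ∞ M] {k : ℕ}
    (D : Fin (k + 1) → Π x : M, Submodule ℝ (TangentSpace (𝓡 m) x)) : Prop :=
  ∀ s : Finset (Fin (k + 1)), IsIntegrable (fun x ↦ ⨆ α ∈ s, D α x)

end Distributions

/-! ### Lorentzian metrics and the Levi-Civita connection -/

/-- A smooth Lorentzian metric, with signature `(-, +, …, +)`: each tangent space has a timelike
vector on whose orthogonal complement the metric is positive definite. -/
structure LorentzianMetric (m : ℕ) (N : Type*) [TopologicalSpace N]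
    [ChartedSpace (EuclideanSpace ℝ (Fin m)) N] [IsManifold (𝓡 m) ∞ N] where
  val : Π p : N, TangentSpace (𝓡 m) p →L[ℝ] TangentSpace (𝓡 m) p →L[ℝ] ℝ
  symm : ∀ p v w, val p v w = val p w v
  lorentzian : ∀ p, ∃ u, val p u u < 0 ∧ ∀ w, val p u w = 0 → w ≠ 0 → 0 < val p w w
  contMDiff : ContMDiff (𝓡 m)
    ((𝓡 m).prod 𝓘(ℝ, EuclideanSpace ℝ (Fin m) →L[ℝ] EuclideanSpace ℝ (Fin m) →L[ℝ] ℝ)) ∞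
    (fun p ↦ TotalSpace.mk' (EuclideanSpace ℝ (Fin m) →L[ℝ] EuclideanSpace ℝ (Fin m) →L[ℝ] ℝ)
      (E := fun p : N ↦ TangentSpace (𝓡 m) p →L[ℝ] TangentSpace (𝓡 m) p →L[ℝ] ℝ) p (val p))

/-- An affine connection on `N`. In `D Y p v` the section `Y` is differentiated along `v`. -/
abbrev AffineConnection (m : ℕ) (N : Type*) [TopologicalSpace N]
    [ChartedSpace (EuclideanSpace ℝ (Fin m)) N] [IsManifold (𝓡 m) ∞ N] :=
  CovariantDerivative (𝓡 m) (EuclideanSpace ℝ (Fin m)) (TangentSpace (𝓡 m) : N → Type _)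

/-- `D` is the Levi-Civita connection of the metric: torsion-free, and
`X (g(Y, Z)) = g(D_X Y, Z) + g(Y, D_X Z)`. -/
structure IsLeviCivita {m : ℕ} {N : Type*} [TopologicalSpace N]
    [ChartedSpace (EuclideanSpace ℝ (Fin m)) N] [IsManifold (𝓡 m) ∞ N]
    (g : LorentzianMetric m N) (D : AffineConnection m N) : Prop where
  torsion_eq_zero : D.torsion = 0
  metric : ∀ (Y Z : Π p : N, TangentSpace (𝓡 m) p) (p : N),
    MDifferentiableAt (𝓡 m) (𝓡 m).tangent (fun q ↦ (⟨q, Y q⟩ : TangentBundle (𝓡 m) N)) p →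
    MDifferentiableAt (𝓡 m) (𝓡 m).tangent (fun q ↦ (⟨q, Z q⟩ : TangentBundle (𝓡 m) N)) p →
    ∀ v : TangentSpace (𝓡 m) p,
      mvfderiv (𝓡 m) (fun q ↦ g.val q (Y q) (Z q)) p v =
        g.val p (D Y p v) (Z p) + g.val p (Y p) (D Z p v)

/-- The derivative at `x` of a vector field `V` along a map `f : M → N`, in the direction `v`, for
an affine connection `D` on `N`: if `V = ∑ Vⁱ • eᵢ ∘ f` near `x` in the coordinate frame `e` of `N`
at `f x`, it is `∑ (dVⁱ(v) • eᵢ + Vⁱ • D_{df v} eᵢ)`. If `V = W ∘ f` this is `D_{df v} W`. -/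
def derivAlong {l m : ℕ} {M N : Type*} [TopologicalSpace M]
    [ChartedSpace (EuclideanSpace ℝ (Fin l)) M] [TopologicalSpace N]
    [ChartedSpace (EuclideanSpace ℝ (Fin m)) N] [IsManifold (𝓡 m) ∞ N]
    (D : AffineConnection m N) (f : M → N) (V : Π x : M, TangentSpace (𝓡 m) (f x))
    (x : M) (v : TangentSpace (𝓡 l) x) : TangentSpace (𝓡 m) (f x) :=
  let e := trivializationAt (EuclideanSpace ℝ (Fin m)) (TangentSpace (𝓡 m) : N → Type _) (f x)
  let b := (EuclideanSpace.basisFun (Fin m) ℝ).toBasis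
  ∑ i : Fin m,
    (mvfderiv (𝓡 l) (fun y ↦ e.localFrameCoeff (𝓡 m) b i (f y) (V y)) x v •
        e.localFrame b i (f x) +
      e.localFrameCoeff (𝓡 m) b i (f x) (V x) •
        D (e.localFrame b i) (f x) (mfderiv (𝓡 l) (𝓡 m) f x v))

/-! ### Lightlike hypersurfaces with a screen distribution -/

section Lightlike

variable {n : ℕ} {Mbar : Type*} [TopologicalSpace Mbar]
  [ChartedSpace (EuclideanSpace ℝ (Fin (n + 2))) Mbar] [IsManifold (𝓡 (n + 2)) ∞ Mbar]
  {M : Type*} [TopologicalSpace M]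
  [ChartedSpace (EuclideanSpace ℝ (Fin (n + 1))) M] [IsManifold (𝓡 (n + 1)) ∞ M]

/-- The metric `g = f^* gbar` induced on `M` by a map `f : M → Mbar`. -/
def inducedMetric (gbar : LorentzianMetric (n + 2) Mbar) (f : M → Mbar) (x : M)
    (v w : TangentSpace (𝓡 (n + 1)) x) : ℝ :=
  gbar.val (f x) (mfderiv (𝓡 (n + 1)) (𝓡 (n + 2)) f x v) (mfderiv (𝓡 (n + 1)) (𝓡 (n + 2)) f x w)

/-- The radical distribution `Rad TM = TM ∩ TM^⊥` of the induced metric. -/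
def radical (gbar : LorentzianMetric (n + 2) Mbar) (f : M → Mbar) (x : M) :
    Submodule ℝ (TangentSpace (𝓡 (n + 1)) x) where
  carrier := {v | ∀ w, inducedMetric gbar f x v w = 0}
  zero_mem' := by intro w; simp [inducedMetric]
  add_mem' := by
    intro a b ha hb w
    have h1 := ha w
    have h2 := hb w
    simp only [inducedMetric, map_add, add_apply] at *
    rw [h1, h2, add_zero]
  smul_mem' := by
    intro c a ha w
    have h1 := ha w
    simp only [inducedMetric, map_smul, smul_apply] at *
    rw [h1, smul_zero]

variable (M) in
/-- A lightlike hypersurface `(M, g, S(TM))` of the Lorentzian manifold `(Mbar, gbar)`: `M`, of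
codimension one, is smoothly immersed in `Mbar`; its radical distribution is spanned by a nowhere
zero smooth vector field `ξ`; and the screen distribution is a smooth complement of it in `TM`. -/
structure LightlikeHypersurface (gbar : LorentzianMetric (n + 2) Mbar) where
  toFun : M → Mbar
  contMDiff : ContMDiff (𝓡 (n + 1)) (𝓡 (n + 2)) ∞ toFun
  injective_mfderiv : ∀ x, Function.Injective (mfderiv (𝓡 (n + 1)) (𝓡 (n + 2)) toFun x)
  ξ : Π x : M, TangentSpace (𝓡 (n + 1)) x
  smooth_ξ : IsSmoothField ξ
  ξ_ne_zero : ∀ x, ξ x ≠ 0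
  radical_eq_span : ∀ x, radical gbar toFun x = Submodule.span ℝ {ξ x}
  screen : Π x : M, Submodule ℝ (TangentSpace (𝓡 (n + 1)) x)
  smooth_screen : IsSmoothDistribution screen
  isCompl_screen : ∀ x, IsCompl (screen x) (radical gbar toFun x)

/-- Linear algebra behind the null transversal vector. -/
theorem exists_null_transversal {V : Type*} [AddCommGroup V] [Module ℝ V] [FiniteDimensional ℝ V]
    (B : V →ₗ[ℝ] V →ₗ[ℝ] ℝ) (hsymm : ∀ v w, B v w = B w v)
    (hnd : ∀ v, (∀ w, B v w = 0) → v = 0) (K : Submodule ℝ V) (e : V) (he : e ∉ K)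
    (hee : B e e = 0) (heK : ∀ w ∈ K, B e w = 0) :
    ∃ N, B N e = 1 ∧ B N N = 0 ∧ ∀ w ∈ K, B N w = 0 := by
  obtain ⟨φ, hφ, hK⟩ := Submodule.exists_le_ker_of_notMem he
  have hinj : Function.Injective B := by
    rw [injective_iff_map_eq_zero]
    intro v hv
    exact hnd v fun w ↦ by rw [hv]; rfl
  have hsurj : Function.Surjective B :=
    (LinearMap.injective_iff_surjective_of_finrank_eq_finrank
      (Subspace.dual_finrank_eq (K := ℝ) (V := V)).symm).1 hinj
  obtain ⟨Z, hZ⟩ := hsurj ((φ e)⁻¹ • φ)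
  have h1 : B Z e = 1 := by rw [hZ]; simp [hφ]
  have h2 : ∀ w ∈ K, B Z w = 0 := by
    intro w hw
    have : φ w = 0 := hK hw
    rw [hZ]; simp [this]
  refine ⟨Z - (B Z Z / 2) • e, ?_, ?_, ?_⟩
  · simp [h1, hee]
  · simp [h1, hee, hsymm e Z]
    ring
  · intro w hw
    simp [h2 w hw, heK w hw]

namespace LightlikeHypersurface

variable {gbar : LorentzianMetric (n + 2) Mbar} (F : LightlikeHypersurface M gbar)

/-- The induced degenerate metric `g`. -/
def metric (x : M) (v w : TangentSpace (𝓡 (n + 1)) x) : ℝ := inducedMetric gbar F.toFun x v w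

/-- The radical distribution `Rad TM`. -/
def rad (x : M) : Submodule ℝ (TangentSpace (𝓡 (n + 1)) x) := radical gbar F.toFun x

/-- The differential of the immersion. -/
abbrev d (x : M) : TangentSpace (𝓡 (n + 1)) x →L[ℝ] TangentSpace (𝓡 (n + 2)) (F.toFun x) :=
  mfderiv (𝓡 (n + 1)) (𝓡 (n + 2)) F.toFun x

/-- `Z` is the null transversal vector at `x` normalised by `ξ`:
`gbar(Z, ξ) = 1` and `gbar(Z, Z) = gbar(Z, W) = 0` for `W` in the screen. -/
def IsNullTransversal (x : M) (Z : TangentSpace (𝓡 (n + 2)) (F.toFun x)) : Prop :=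
  gbar.val (F.toFun x) Z (F.d x (F.ξ x)) = 1 ∧ gbar.val (F.toFun x) Z Z = 0 ∧
    ∀ w ∈ F.screen x, gbar.val (F.toFun x) Z (F.d x w) = 0

theorem ξ_mem_rad (x : M) : F.ξ x ∈ F.rad x := by
  unfold rad
  rw [F.radical_eq_span]
  exact Submodule.mem_span_singleton_self _

theorem exists_isNullTransversal (x : M) : ∃ Z, F.IsNullTransversal x Z := by
  have hξ : ∀ w, gbar.val (F.toFun x) (F.d x (F.ξ x)) (F.d x w) = 0 := F.ξ_mem_rad x
  have : FiniteDimensional ℝ (TangentSpace (𝓡 (n + 2)) (F.toFun x)) :=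
    inferInstanceAs (FiniteDimensional ℝ (EuclideanSpace ℝ (Fin (n + 2))))
  let B : TangentSpace (𝓡 (n + 2)) (F.toFun x) →ₗ[ℝ]
      TangentSpace (𝓡 (n + 2)) (F.toFun x) →ₗ[ℝ] ℝ :=
    { toFun := fun v ↦ (gbar.val (F.toFun x) v : TangentSpace (𝓡 (n + 2)) (F.toFun x) →ₗ[ℝ] ℝ)
      map_add' := by intro a b; ext w; simp
      map_smul' := by intro c a; ext w; simp }
  have hB : ∀ v w, B v w = gbar.val (F.toFun x) v w := fun _ _ ↦ rfl
  obtain ⟨Z, h1, h2, h3⟩ := exists_null_transversal B (fun v w ↦ gbar.symm _ v w) (by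
      intro v hv
      obtain ⟨u, -, hu⟩ := gbar.lorentzian (F.toFun x)
      by_contra hne
      have h := hu v (by rw [gbar.symm]; exact hv u) hne
      have h' : gbar.val (F.toFun x) v v = 0 := hv v
      linarith)
    ((F.screen x).map (F.d x : TangentSpace (𝓡 (n + 1)) x →ₗ[ℝ] _)) (F.d x (F.ξ x)) (by
      rintro ⟨w, hw, hwe⟩
      have : w = F.ξ x := F.injective_mfderiv x hwe
      exact F.ξ_ne_zero x ((Submodule.disjoint_def.1 (F.isCompl_screen x).disjoint) _
        (this ▸ hw) (F.ξ_mem_rad x)))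
    (hξ _) (by rintro _ ⟨w, -, rfl⟩; exact hξ w)
  exact ⟨Z, h1, h2, fun w hw ↦ h3 _ ⟨w, hw, rfl⟩⟩

/-- The null transversal vector field `N` along `M`, which spans `tr(TM)`. -/
def transversal (x : M) : TangentSpace (𝓡 (n + 2)) (F.toFun x) :=
  Classical.choose (F.exists_isNullTransversal x)

theorem transversal_spec (x : M) : F.IsNullTransversal x (F.transversal x) :=
  Classical.choose_spec (F.exists_isNullTransversal x)

/-- The decomposition `T Mbar |_M = TM ⊕ tr(TM)`. -/
theorem isCompl_transversal (x : M) :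
    IsCompl (LinearMap.range (F.d x : TangentSpace (𝓡 (n + 1)) x →ₗ[ℝ] _))
      (Submodule.span ℝ {F.transversal x}) := by
  obtain ⟨h1, -, -⟩ := F.transversal_spec x
  have hξ : ∀ w, gbar.val (F.toFun x) (F.d x (F.ξ x)) (F.d x w) = 0 := F.ξ_mem_rad x
  have : FiniteDimensional ℝ (TangentSpace (𝓡 (n + 2)) (F.toFun x)) :=
    inferInstanceAs (FiniteDimensional ℝ (EuclideanSpace ℝ (Fin (n + 2))))
  rw [Submodule.isCompl_iff_disjoint]
  · rw [Submodule.disjoint_def]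
    rintro _ ⟨w, rfl⟩ hw
    obtain ⟨c, hc⟩ := Submodule.mem_span_singleton.1 hw
    have h2 := hξ w
    rw [gbar.symm] at h2
    have hc' : c • F.transversal x = F.d x w := hc
    rw [← hc', map_smul, smul_apply, h1] at h2
    have h3 : c = 0 := by simpa using h2
    rw [← hc, h3, zero_smul]
  · have hN : F.transversal x ≠ 0 := by
      intro h
      rw [h] at h1
      simp at h1
    rw [finrank_span_singleton hN, LinearMap.finrank_range_of_inj (F.injective_mfderiv x)]
    have e1 : Module.finrank ℝ (TangentSpace (𝓡 (n + 2)) (F.toFun x)) = n + 2 :=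
      finrank_euclideanSpace_fin (𝕜 := ℝ) (n := n + 2)
    have e2 : Module.finrank ℝ (TangentSpace (𝓡 (n + 1)) x) = n + 1 :=
      finrank_euclideanSpace_fin (𝕜 := ℝ) (n := n + 1)
    omega

/-- The projection `Q` of `T Mbar |_M = TM ⊕ tr(TM)` onto `TM`. -/
def tangentProj (x : M) :
    TangentSpace (𝓡 (n + 2)) (F.toFun x) →ₗ[ℝ] TangentSpace (𝓡 (n + 1)) x :=
  (LinearEquiv.ofInjective (F.d x : TangentSpace (𝓡 (n + 1)) x →ₗ[ℝ] _)
      (F.injective_mfderiv x)).symm.toLinearMap ∘ₗ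
    Submodule.projectionOnto _ _ (F.isCompl_transversal x)

/-- The projection `P` of `TM = S(TM) ⊕ Rad TM` onto the screen distribution. -/
def screenProj (x : M) : TangentSpace (𝓡 (n + 1)) x →ₗ[ℝ] TangentSpace (𝓡 (n + 1)) x :=
  Submodule.projection _ _ (F.isCompl_screen x)

/-- The one-form `η = gbar(N, ·)` on `M`. -/
def η (x : M) (v : TangentSpace (𝓡 (n + 1)) x) : ℝ :=
  gbar.val (F.toFun x) (F.transversal x) (F.d x v)

/-- The duality isomorphism `v^♭ = g(v, ·) + η(v) η(·)`. -/
def flat (x : M) (v w : TangentSpace (𝓡 (n + 1)) x) : ℝ :=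
  F.metric x v w + F.η x v * F.η x w

variable (Dbar : AffineConnection (n + 2) Mbar)

/-- The derivative `Dbar_v Y` in `T Mbar |_M` of a vector field `Y` on `M`. -/
def ambientDeriv (Y : Π x : M, TangentSpace (𝓡 (n + 1)) x) (x : M)
    (v : TangentSpace (𝓡 (n + 1)) x) : TangentSpace (𝓡 (n + 2)) (F.toFun x) :=
  derivAlong Dbar F.toFun (fun y ↦ F.d y (Y y)) x v

/-- The induced connection `∇_v Y = Q (Dbar_v Y)`. -/
def inducedConnection (Y : Π x : M, TangentSpace (𝓡 (n + 1)) x) (x : M)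
    (v : TangentSpace (𝓡 (n + 1)) x) : TangentSpace (𝓡 (n + 1)) x :=
  F.tangentProj x (F.ambientDeriv Dbar Y x v)

/-- The second fundamental form `h(v, Y) = Dbar_v Y - ∇_v Y`. -/
def secondFundamentalForm (Y : Π x : M, TangentSpace (𝓡 (n + 1)) x) (x : M)
    (v : TangentSpace (𝓡 (n + 1)) x) : TangentSpace (𝓡 (n + 2)) (F.toFun x) :=
  F.ambientDeriv Dbar Y x v - F.d x (F.inducedConnection Dbar Y x v)

/-- `M` is totally geodesic: its second fundamental form vanishes. -/
def IsTotallyGeodesic : Prop :=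
  ∀ Y : Π x : M, TangentSpace (𝓡 (n + 1)) x, IsSmoothField Y →
    ∀ x v, F.secondFundamentalForm Dbar Y x v = 0

/-- `∇S(X, Y) = ∇_X (S Y) - S (∇_X Y)` for an endomorphism field `S` of `TM`. -/
def nablaTensor (S : Π x : M, TangentSpace (𝓡 (n + 1)) x →L[ℝ] TangentSpace (𝓡 (n + 1)) x)
    (X Y : Π x : M, TangentSpace (𝓡 (n + 1)) x) (x : M) : TangentSpace (𝓡 (n + 1)) x :=
  F.inducedConnection Dbar (fun y ↦ S y (Y y)) x (X x) -
    S x (F.inducedConnection Dbar Y x (X x))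

/-- `S` is an `A^∇`-tensor on `(M, g, S(TM))`: a smooth endomorphism field of `TM` that commutes
with the projection on the screen, is `g`-symmetric, and satisfies `X^♭(∇S(X, X)) = 0`. -/
structure IsATensor (S : Π x : M, TangentSpace (𝓡 (n + 1)) x →L[ℝ] TangentSpace (𝓡 (n + 1)) x) :
    Prop where
  contMDiff : ContMDiff (𝓡 (n + 1))
    ((𝓡 (n + 1)).prod 𝓘(ℝ, EuclideanSpace ℝ (Fin (n + 1)) →L[ℝ] EuclideanSpace ℝ (Fin (n + 1)))) ∞
    (fun x ↦ TotalSpace.mk' (EuclideanSpace ℝ (Fin (n + 1)) →L[ℝ] EuclideanSpace ℝ (Fin (n + 1)))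
      (E := fun x : M ↦ TangentSpace (𝓡 (n + 1)) x →L[ℝ] TangentSpace (𝓡 (n + 1)) x) x (S x))
  screen_preserving : ∀ x v, F.screenProj x (S x v) = S x (F.screenProj x v)
  symmetric : ∀ x v w, F.metric x (S x v) w = F.metric x v (S x w)
  flat_nabla : ∀ X : Π x : M, TangentSpace (𝓡 (n + 1)) x, IsSmoothField X →
    ∀ x, F.flat x (X x) (F.nablaTensor Dbar S X X x) = 0

/-- An `A^∇`-tensor `S` is isotropic if `∇S` takes its values in `Rad TM`. -/
structure IsIsotropicATensor
    (S : Π x : M, TangentSpace (𝓡 (n + 1)) x →L[ℝ] TangentSpace (𝓡 (n + 1)) x) : Prop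
    extends F.IsATensor Dbar S where
  nabla_mem_rad : ∀ X Y : Π x : M, TangentSpace (𝓡 (n + 1)) x, IsSmoothField X → IsSmoothField Y →
    ∀ x, F.nablaTensor Dbar S X Y x ∈ F.rad x

end LightlikeHypersurface

end Lightlike

/-- `S` has the constant eigenfunctions `c 0, …, c k`: these numbers are distinct and are exactly
the eigenvalues of `S` at every point. -/
structure HasConstantEigenvalues {m : ℕ} {M : Type*} [TopologicalSpace M]
    [ChartedSpace (EuclideanSpace ℝ (Fin m)) M]
    (S : Π x : M, TangentSpace (𝓡 m) x →L[ℝ] TangentSpace (𝓡 m) x) {k : ℕ}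
    (c : Fin (k + 1) → ℝ) : Prop where
  injective : Function.Injective c
  hasEigenvalue_iff : ∀ (x : M) (r : ℝ),
    Module.End.HasEigenvalue (S x : TangentSpace (𝓡 m) x →ₗ[ℝ] TangentSpace (𝓡 m) x) r ↔
      ∃ α, c α = r

/-- The eigendistribution `Ker(r I - S)`. -/
def eigendistribution {m : ℕ} {M : Type*} [TopologicalSpace M]
    [ChartedSpace (EuclideanSpace ℝ (Fin m)) M]
    (S : Π x : M, TangentSpace (𝓡 m) x →L[ℝ] TangentSpace (𝓡 m) x) (r : ℝ) (x : M) :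
    Submodule ℝ (TangentSpace (𝓡 m) x) :=
  Module.End.eigenspace (S x : TangentSpace (𝓡 m) x →ₗ[ℝ] TangentSpace (𝓡 m) x) r

end LightlikeGeometry

end

/-! Write `T(X, Y, Z) = g(∇_X Y, Z)`, which is `metricDeriv`. Because the eigenvalues are constant,
`g(∇S(X, Y), Z) = (λ_β - λ_γ) T(X, Y, Z)` for `Y` in `D_β` and `Z` in `D_γ`. So `∇S` is radical as
soon as `T` vanishes on sections of eigendistributions whenever those of `Y` and `Z` differ
(`IsATensor.metricDeriv_eq_zero`).

Total geodesy makes `∇` torsion-free and compatible with the degenerate `g`. Two symmetries follow.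
Eigendistributions for different eigenvalues are `g`-orthogonal, so `T` is skew in `Y, Z`
(`metricDeriv_swap`). If the eigenvalue of `Z` differs from those of `X` and `Y`, integrability puts
`[X, Y]` in a sum orthogonal to `Z`, so `T` is symmetric in `X, Y` (`metricDeriv_comm`).

Three distinct eigenvalues: alternating the two symmetries returns to `T(X, Y, Z)` with the opposite
sign. `X` and `Y` with the same eigenvalue: the condition `U^♭(∇S(U, U)) = 0` for `U = X + Z`, with
values in the screen at the point, gives `T(X, X, Z) = 0` after rescaling `X`, and polarisation
gives `T(X, Y, Z) = 0`; radical components contribute nothing by the two symmetries. `X` and `Z`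
with the same eigenvalue: swap `Y` and `Z`.

Arbitrary fields are sums of eigensections: `S` is symmetric for the positive definite form `g + η ⊗
η`, hence diagonalisable, and its spectral projections are fixed polynomials in `S`, hence smooth.
-/

noncomputable section

namespace LightlikeGeometry

/-! ### The Lie bracket as a commutator of derivations, by computation in a chart. -/

section Bracket

open VectorField Filter
open scoped Topology

variable {m : ℕ} {M : Type*} [TopologicalSpace M] [ChartedSpace (EuclideanSpace ℝ (Fin m)) M]
  {G : Type*} [NormedAddCommGroup G] [NormedSpace ℝ G]

theorem mvfderiv_congr {x : M} {f h : M → G} (hfh : f =ᶠ[𝓝 x] h) :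
    mvfderiv (𝓡 m) f x = mvfderiv (𝓡 m) h x := by
  ext v
  have e : mfderiv (𝓡 m) 𝓘(ℝ, G) f x = mfderiv (𝓡 m) 𝓘(ℝ, G) h x := hfh.mfderiv_eq
  exact congrArg (fun L : TangentSpace (𝓡 m) x →L[ℝ] G ↦ L v) e

variable [IsManifold (𝓡 m) ∞ M]

/-- The representative of a vector field in the chart at `x`. -/
def chartField (x : M) (V : Π y : M, TangentSpace (𝓡 m) y) :
    EuclideanSpace ℝ (Fin m) → EuclideanSpace ℝ (Fin m) :=
  mpullbackWithin 𝓘(ℝ, EuclideanSpace ℝ (Fin m)) (𝓡 m) (extChartAt (𝓡 m) x).symm V (range (𝓡 m))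

/-- The identity is needed on a neighbourhood of `x`, not only at `x`, because it gets
differentiated. -/
theorem eventually_mfderiv_extChartAt_apply (x : M) (V : Π y : M, TangentSpace (𝓡 m) y) :
    ∀ᶠ y in 𝓝 x, mfderiv (𝓡 m) 𝓘(ℝ, EuclideanSpace ℝ (Fin m)) (extChartAt (𝓡 m) x) y (V y) =
      chartField x V (extChartAt (𝓡 m) x y) := by
  have h := eventuallyEq_mpullback_mpullbackWithin_extChartAt (I := 𝓡 m) (s := univ) (x := x) V
  rw [nhdsWithin_univ] at h
  filter_upwards [h, extChartAt_source_mem_nhds (I := 𝓡 m) x] with y hy hs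
  rw [hy, mpullback_apply]
  have hinv := isInvertible_mfderiv_extChartAt (I := 𝓡 m) hs
  exact hinv.self_apply_inverse _

theorem differentiableAt_chartField {x : M} {V : Π y : M, TangentSpace (𝓡 m) y}
    (hV : MDifferentiableAt (𝓡 m) (𝓡 m).tangent
      (fun y ↦ (⟨y, V y⟩ : TangentBundle (𝓡 m) M)) x) :
    DifferentiableAt ℝ (chartField x V) (extChartAt (𝓡 m) x x) := by
  have h := MDifferentiableWithinAt.differentiableWithinAt_mpullbackWithin_vectorField
    (I := 𝓡 m) (s := univ) (mdifferentiableWithinAt_univ.2 hV)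
  rw [preimage_univ, univ_inter, modelWithCornersSelf_coe, range_id] at h
  unfold chartField
  rw [modelWithCornersSelf_coe, range_id]
  exact differentiableWithinAt_univ.1 h

theorem mfderiv_extChartAt_mlieBracket (x : M) (V W : Π y : M, TangentSpace (𝓡 m) y) :
    mfderiv (𝓡 m) 𝓘(ℝ, EuclideanSpace ℝ (Fin m)) (extChartAt (𝓡 m) x) x
      (mlieBracket (𝓡 m) V W x) =
    lieBracket ℝ (chartField x V) (chartField x W) (extChartAt (𝓡 m) x x) := by
  rw [← mlieBracketWithin_univ, mlieBracketWithin_apply, preimage_univ, univ_inter]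
  refine ((isInvertible_mfderiv_extChartAt (I := 𝓡 m)
    (mem_extChartAt_source x)).self_apply_inverse _).trans ?_
  unfold chartField
  rw [modelWithCornersSelf_coe, range_id]
  exact congrFun (lieBracketWithin_univ (𝕜 := ℝ) (E := EuclideanSpace ℝ (Fin m))) _

/-- The Lie bracket is the commutator of derivations. -/
theorem mvfderiv_mlieBracket {x : M} {h : M → G}
    (hh : ContMDiffAt (𝓡 m) 𝓘(ℝ, G) ∞ h x) {V W : Π y : M, TangentSpace (𝓡 m) y}
    (hV : MDifferentiableAt (𝓡 m) (𝓡 m).tangent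
      (fun y ↦ (⟨y, V y⟩ : TangentBundle (𝓡 m) M)) x)
    (hW : MDifferentiableAt (𝓡 m) (𝓡 m).tangent
      (fun y ↦ (⟨y, W y⟩ : TangentBundle (𝓡 m) M)) x) :
    mvfderiv (𝓡 m) (fun y ↦ mvfderiv (𝓡 m) h y (W y)) x (V x) -
      mvfderiv (𝓡 m) (fun y ↦ mvfderiv (𝓡 m) h y (V y)) x (W x) =
    mvfderiv (𝓡 m) h x (mlieBracket (𝓡 m) V W x) := by
  let E := EuclideanSpace ℝ (Fin m)
  let ψ := extChartAt (𝓡 m) x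
  let k : E → G := h ∘ ψ.symm
  have hk : ContDiffAt ℝ ∞ k (ψ x) := by
    have := (contMDiffAt_iff_source (x := x)).1 hh
    rw [modelWithCornersSelf_coe, range_id, contMDiffWithinAt_univ] at this
    exact this.contDiffAt
  have hψ : ∀ᶠ y in 𝓝 x, MDifferentiableAt (𝓡 m) 𝓘(ℝ, E) ψ y := by
    filter_upwards [(chartAt E x).open_source.mem_nhds (mem_chart_source E x)] with y hy
    exact mdifferentiableAt_extChartAt hy
  have hcont : ContinuousAt ψ x := continuousAt_extChartAt x
  have hkd : ∀ᶠ y in 𝓝 x, DifferentiableAt ℝ k (ψ y) :=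
    hcont.eventually (((hk.of_le (m := 1) (by simp)).eventually (by simp)).mono
      fun z hz ↦ hz.differentiableAt (by simp))
  have hhk : ∀ᶠ y in 𝓝 x, h y = k (ψ y) := by
    filter_upwards [extChartAt_source_mem_nhds (I := 𝓡 m) x] with y hy
    exact congrArg h ((extChartAt (𝓡 m) x).left_inv hy).symm
  have chain : ∀ (l : E → G) (y : M), DifferentiableAt ℝ l (ψ y) →
      MDifferentiableAt (𝓡 m) 𝓘(ℝ, E) ψ y → ∀ v,
      mvfderiv (𝓡 m) (fun z ↦ l (ψ z)) y v =
        fderiv ℝ l (ψ y) (mfderiv (𝓡 m) 𝓘(ℝ, E) ψ y v) := by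
    intro l y hl hy v
    have := mfderiv_comp_apply (I := 𝓡 m) (I' := 𝓘(ℝ, E)) (I'' := 𝓘(ℝ, G)) y
      hl.mdifferentiableAt hy v
    rw [mfderiv_eq_fderiv] at this
    exact this
  have first : ∀ U : Π y : M, TangentSpace (𝓡 m) y, ∀ᶠ y in 𝓝 x,
      mvfderiv (𝓡 m) h y (U y) = fderiv ℝ k (ψ y) (chartField x U (ψ y)) := by
    intro U
    filter_upwards [hψ, hkd, hhk.eventually_nhds, eventually_mfderiv_extChartAt_apply x U]
      with y h1 h2 h3 h4
    rw [← h4, ← chain k y h2 h1]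
    rw [mvfderiv_congr h3]
  have htwo : (2 : ℕ∞ω) ≤ ∞ := ENat.LEInfty.out
  have hk1 : DifferentiableAt ℝ (fderiv ℝ k) (ψ x) :=
    (hk.fderiv_right (m := 1) (by rw [one_add_one_eq_two]; exact htwo)).differentiableAt (by simp)
  -- Product rule in the chart: `Z(U h) = D²k(Z, U) + Dk(DU · Z)`. The Hessian term is symmetric and
  -- cancels in the commutator, leaving `Dk` of the flat bracket.
  have second : ∀ U Z : Π y : M, TangentSpace (𝓡 m) y,
      MDifferentiableAt (𝓡 m) (𝓡 m).tangent (fun y ↦ (⟨y, U y⟩ : TangentBundle (𝓡 m) M)) x →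
      mvfderiv (𝓡 m) (fun y ↦ mvfderiv (𝓡 m) h y (U y)) x (Z x) =
        fderiv ℝ (fderiv ℝ k) (ψ x) (chartField x Z (ψ x)) (chartField x U (ψ x)) +
          fderiv ℝ k (ψ x) (fderiv ℝ (chartField x U) (ψ x) (chartField x Z (ψ x))) := by
    intro U Z hU
    have hU' := differentiableAt_chartField hU
    have e1 : mvfderiv (𝓡 m) (fun y ↦ mvfderiv (𝓡 m) h y (U y)) x =
        mvfderiv (𝓡 m) (fun y ↦ fderiv ℝ k (ψ y) (chartField x U (ψ y))) x :=
      mvfderiv_congr (first U)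
    rw [e1, chain (fun z ↦ fderiv ℝ k z (chartField x U z)) x (hk1.clm_apply hU')
      hψ.self_of_nhds, (eventually_mfderiv_extChartAt_apply x Z).self_of_nhds,
      fderiv_clm_apply hk1 hU']
    simp [add_comm]
    rfl
  have hsymm : IsSymmSndFDerivAt ℝ k (ψ x) :=
    hk.isSymmSndFDerivAt (by simpa using htwo)
  rw [second W V hW, second V W hV, hsymm.eq, add_sub_add_left_eq_sub, ← map_sub]
  have e2 : mvfderiv (𝓡 m) h x = mvfderiv (𝓡 m) (fun y ↦ k (ψ y)) x :=
    mvfderiv_congr hhk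
  rw [e2, chain k x hkd.self_of_nhds hψ.self_of_nhds]
  congr 1
  exact (mfderiv_extChartAt_mlieBracket x V W).symm

end Bracket

/-! ### Coordinate frames: coefficients as differentials of coordinates, and vanishing brackets. -/

section CoordinateFrame

open VectorField Filter
open scoped Topology

variable {m : ℕ} {N : Type*} [TopologicalSpace N] [ChartedSpace (EuclideanSpace ℝ (Fin m)) N]

/-- The `i`-th coordinate function of the chart at `p`. -/
def coordFun (p : N) (i : Fin m) (q : N) : ℝ := extChartAt (𝓡 m) p q i

variable [IsManifold (𝓡 m) ∞ N]

/-- The `i`-th field of the coordinate frame of the chart at `p`. -/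
def coordFrame (p : N) (i : Fin m) : Π q : N, TangentSpace (𝓡 m) q :=
  (trivializationAt (EuclideanSpace ℝ (Fin m)) (TangentSpace (𝓡 m) : N → Type _) p).localFrame
    (EuclideanSpace.basisFun (Fin m) ℝ).toBasis i

theorem contMDiffAt_coordFun {p q : N} (hq : q ∈ (chartAt (EuclideanSpace ℝ (Fin m)) p).source)
    (i : Fin m) : ContMDiffAt (𝓡 m) 𝓘(ℝ, ℝ) ∞ (coordFun p i) q := by
  have h : ContMDiffAt (𝓡 m) 𝓘(ℝ, EuclideanSpace ℝ (Fin m)) ∞ (extChartAt (𝓡 m) p) q :=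
    contMDiffAt_extChartAt' hq
  exact (EuclideanSpace.proj (𝕜 := ℝ) i :
    EuclideanSpace ℝ (Fin m) →L[ℝ] ℝ).contMDiff.contMDiffAt.comp q h

theorem trivializationAt_snd_apply {p q : N}
    (hq : q ∈ (chartAt (EuclideanSpace ℝ (Fin m)) p).source) (i : Fin m)
    (w : TangentSpace (𝓡 m) q) :
    ((trivializationAt (EuclideanSpace ℝ (Fin m)) (TangentSpace (𝓡 m) : N → Type _) p)
      ⟨q, w⟩).2 i = mvfderiv (𝓡 m) (coordFun p i) q w := by
  have h1 := TangentBundle.continuousLinearMapAt_trivializationAt (I := 𝓡 m) hq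
  have h2 : ((trivializationAt (EuclideanSpace ℝ (Fin m)) (TangentSpace (𝓡 m) : N → Type _) p)
      ⟨q, w⟩).2 =
      mfderiv (𝓡 m) 𝓘(ℝ, EuclideanSpace ℝ (Fin m)) (extChartAt (𝓡 m) p) q (w) := by
    refine Eq.trans ?_ (congrArg (fun L : TangentSpace (𝓡 m) q →L[ℝ] EuclideanSpace ℝ (Fin m) ↦
      L w) h1)
    rw [Trivialization.continuousLinearMapAt_apply,
      Trivialization.coe_linearMapAt_of_mem _ (by simpa using hq)]
  have h3 := mfderiv_comp_apply (I := 𝓡 m) (I' := 𝓘(ℝ, EuclideanSpace ℝ (Fin m)))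
    (I'' := 𝓘(ℝ, ℝ)) q
    (g := fun u : EuclideanSpace ℝ (Fin m) ↦ u i)
    (EuclideanSpace.proj (𝕜 := ℝ) i :
      EuclideanSpace ℝ (Fin m) →L[ℝ] ℝ).differentiableAt.mdifferentiableAt
    (mdifferentiableAt_extChartAt hq) (w)
  rw [← h2, mfderiv_eq_fderiv] at h3
  have h4 : fderiv ℝ (fun u : EuclideanSpace ℝ (Fin m) ↦ u i) (extChartAt (𝓡 m) p q) =
    (EuclideanSpace.proj (𝕜 := ℝ) i : EuclideanSpace ℝ (Fin m) →L[ℝ] ℝ) :=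
    (EuclideanSpace.proj (𝕜 := ℝ) i : EuclideanSpace ℝ (Fin m) →L[ℝ] ℝ).fderiv
  rw [h4] at h3
  exact h3.symm

/-- Turns bundle-theoretic coefficients into derivatives of functions, to which the chain rule and
`mvfderiv_mlieBracket` apply. -/
theorem localFrameCoeff_eq_mvfderiv {p q : N}
    (hq : q ∈ (chartAt (EuclideanSpace ℝ (Fin m)) p).source) (i : Fin m)
    (w : TangentSpace (𝓡 m) q) :
    (trivializationAt (EuclideanSpace ℝ (Fin m)) (TangentSpace (𝓡 m) : N → Type _)
      p).localFrameCoeff (𝓡 m) (EuclideanSpace.basisFun (Fin m) ℝ).toBasis i q w =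
    mvfderiv (𝓡 m) (coordFun p i) q w := by
  -- Frame coefficients are described for sections, so `w` is extended by zero; no smoothness is
  -- required.
  obtain ⟨s, rfl⟩ : ∃ s : Π q : N, TangentSpace (𝓡 m) q, s q = w := by
    classical exact ⟨Function.update 0 q w, by simp⟩
  rw [Trivialization.localFrameCoeff_eq_coeff _ (by simpa using hq),
    ← trivializationAt_snd_apply hq]
  rfl

theorem sum_mvfderiv_coordFun_smul {p q : N}
    (hq : q ∈ (chartAt (EuclideanSpace ℝ (Fin m)) p).source) (w : TangentSpace (𝓡 m) q) :
    ∑ i, mvfderiv (𝓡 m) (coordFun p i) q w • coordFrame p i q = w := by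
  obtain ⟨s, rfl⟩ : ∃ s : Π q : N, TangentSpace (𝓡 m) q, s q = w := by
    classical exact ⟨Function.update 0 q w, by simp⟩
  simp_rw [← localFrameCoeff_eq_mvfderiv hq]
  exact (Trivialization.eq_sum_localFrameCoeff_smul (by simpa using hq)).symm

theorem mvfderiv_coordFun_coordFrame {p q : N}
    (hq : q ∈ (chartAt (EuclideanSpace ℝ (Fin m)) p).source) (i j : Fin m) :
    mvfderiv (𝓡 m) (coordFun p i) q (coordFrame p j q) = if j = i then 1 else 0 := by
  rw [← localFrameCoeff_eq_mvfderiv hq,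
    Trivialization.localFrameCoeff_apply_of_mem_baseSet _ _ (by simpa using hq), coordFrame,
    Trivialization.localFrame_apply_of_mem_baseSet _ _ (by simpa using hq)]
  simp [Finsupp.single_apply]

theorem contMDiffAt_coordFrame {p q : N}
    (hq : q ∈ (chartAt (EuclideanSpace ℝ (Fin m)) p).source) (i : Fin m) :
    ContMDiffAt (𝓡 m) (𝓡 m).tangent ∞
      (fun q ↦ (⟨q, coordFrame p i q⟩ : TangentBundle (𝓡 m) N)) q :=
  contMDiffAt_localFrame_of_mem _ _ _ _ (by simpa using hq)

/-- Each frame field sends each coordinate function to a locally constant function (a Kronecker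
delta), so the commutator kills all coordinate functions. -/
theorem mlieBracket_coordFrame (p : N) (i j : Fin m) :
    mlieBracket (𝓡 m) (coordFrame p i) (coordFrame p j) p = 0 := by
  have hp := mem_chart_source (EuclideanSpace ℝ (Fin m)) p
  rw [← sum_mvfderiv_coordFun_smul hp (mlieBracket (𝓡 m) (coordFrame p i) (coordFrame p j) p)]
  refine Finset.sum_eq_zero fun k _ ↦ ?_
  have hconst : ∀ l, mvfderiv (𝓡 m)
      (fun y ↦ mvfderiv (𝓡 m) (coordFun p k) y (coordFrame p l y)) p = 0 := by
    intro l
    have : (fun y ↦ mvfderiv (𝓡 m) (coordFun p k) y (coordFrame p l y)) =ᶠ[𝓝 p]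
        fun _ ↦ if l = k then (1 : ℝ) else 0 := by
      filter_upwards [(chartAt _ p).open_source.mem_nhds hp] with y hy
      exact mvfderiv_coordFun_coordFrame hy k l
    rw [mvfderiv_congr this, mvfderiv_const]
  rw [← mvfderiv_mlieBracket (contMDiffAt_coordFun hp k)
    ((contMDiffAt_coordFrame hp i).mdifferentiableAt (by simp))
    ((contMDiffAt_coordFrame hp j).mdifferentiableAt (by simp)), hconst, hconst]
  simp

end CoordinateFrame

/-! ### Calculus of the derivative along a map: linearity, torsion and metric compatibility. -/

section DerivAlong

open VectorField Filter
open scoped Topology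

variable {l m : ℕ} {M : Type*} [TopologicalSpace M] [ChartedSpace (EuclideanSpace ℝ (Fin l)) M]
  [IsManifold (𝓡 l) ∞ M]
  {N : Type*} [TopologicalSpace N] [ChartedSpace (EuclideanSpace ℝ (Fin m)) N]

omit [IsManifold (𝓡 l) ∞ M] in
theorem mvfderiv_sum_apply {ι : Type} (s : Finset ι) {F : ι → M → ℝ} {x : M}
    (hF : ∀ i ∈ s, MDifferentiableAt (𝓡 l) 𝓘(ℝ, ℝ) (F i) x) (v : TangentSpace (𝓡 l) x) :
    mvfderiv (𝓡 l) (fun y ↦ ∑ i ∈ s, F i y) x v = ∑ i ∈ s, mvfderiv (𝓡 l) (F i) x v := by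
  have h := (HasMFDerivAt.sum (t := s) (f := F) (f' := fun i ↦ mfderiv (𝓡 l) 𝓘(ℝ, ℝ) (F i) x)
    fun i hi ↦ (hF i hi).hasMFDerivAt).mfderiv
  have e : (∑ i ∈ s, F i) = fun y ↦ ∑ i ∈ s, F i y := by ext y; simp
  rw [e] at h
  have h' := congrArg (fun L : TangentSpace (𝓡 l) x →L[ℝ] ℝ ↦ L v) h
  exact h'.trans (sum_apply s (fun i ↦ mvfderiv (𝓡 l) (F i) x) v)

variable [IsManifold (𝓡 m) ∞ N]

/-- The coefficients of `df Y` in the coordinate frame at `f x`. -/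
def pushCoeff (f : M → N) (x : M) (Y : Π y : M, TangentSpace (𝓡 l) y) (i : Fin m) (y : M) : ℝ :=
  mvfderiv (𝓡 m) (coordFun (f x) i) (f y) (mfderiv (𝓡 l) (𝓡 m) f y (Y y))

variable {f : M → N}

omit [IsManifold (𝓡 m) ∞ N] [IsManifold (𝓡 l) ∞ M] in
theorem eventually_mem_chart_source (hf : ContMDiff (𝓡 l) (𝓡 m) ∞ f) (x : M) :
    ∀ᶠ y in 𝓝 x, f y ∈ (chartAt (EuclideanSpace ℝ (Fin m)) (f x)).source :=
  hf.continuous.continuousAt.eventually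
    ((chartAt _ (f x)).open_source.mem_nhds (mem_chart_source _ _))

theorem contMDiff_mfderiv_apply (hf : ContMDiff (𝓡 l) (𝓡 m) ∞ f)
    {Y : Π y : M, TangentSpace (𝓡 l) y} (hY : IsSmoothField Y) :
    ContMDiff (𝓡 l) (𝓡 m).tangent ∞
      (fun y ↦ (⟨f y, mfderiv (𝓡 l) (𝓡 m) f y (Y y)⟩ : TangentBundle (𝓡 m) N)) :=
  (hf.contMDiff_tangentMap (m := ∞) le_rfl).comp hY

theorem mdifferentiableAt_pushCoeff (hf : ContMDiff (𝓡 l) (𝓡 m) ∞ f) (x : M)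
    {Y : Π y : M, TangentSpace (𝓡 l) y} (hY : IsSmoothField Y) (i : Fin m) :
    MDifferentiableAt (𝓡 l) 𝓘(ℝ, ℝ) (pushCoeff f x Y i) x := by
  have h := (contMDiffAt_totalSpace.1 ((contMDiff_mfderiv_apply hf hY) x)).2
  have h2 := ((EuclideanSpace.proj (𝕜 := ℝ) i : EuclideanSpace ℝ (Fin m) →L[ℝ]
    ℝ).contMDiff.contMDiffAt.comp x h).mdifferentiableAt (by simp)
  refine h2.congr_of_eventuallyEq ?_
  filter_upwards [eventually_mem_chart_source hf x] with y hy
  exact (trivializationAt_snd_apply hy i _).symm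

omit [IsManifold (𝓡 l) ∞ M] in
theorem sum_pushCoeff_smul (hf : ContMDiff (𝓡 l) (𝓡 m) ∞ f) (x : M)
    (Y : Π y : M, TangentSpace (𝓡 l) y) :
    ∀ᶠ y in 𝓝 x, mfderiv (𝓡 l) (𝓡 m) f y (Y y) =
      ∑ i, pushCoeff f x Y i y • coordFrame (f x) i (f y) := by
  filter_upwards [eventually_mem_chart_source hf x] with y hy
  exact (sum_mvfderiv_coordFun_smul hy _).symm

-- The coefficients of `df Y` are `Y` applied to the functions `φ_i ∘ f` on `M`; this is how
-- brackets on `M` enter the torsion identity.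
omit [IsManifold (𝓡 l) ∞ M] in
theorem pushCoeff_eq_mvfderiv_comp (hf : ContMDiff (𝓡 l) (𝓡 m) ∞ f) (x : M)
    (Y : Π y : M, TangentSpace (𝓡 l) y) (i : Fin m) :
    ∀ᶠ y in 𝓝 x, pushCoeff f x Y i y = mvfderiv (𝓡 l) (coordFun (f x) i ∘ f) y (Y y) := by
  filter_upwards [eventually_mem_chart_source hf x] with y hy
  exact (mvfderiv_comp_apply y ((contMDiffAt_coordFun hy i).mdifferentiableAt (by simp))
    (hf.mdifferentiableAt (by simp)) (Y y)).symm

variable (D : AffineConnection m N)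

omit [IsManifold (𝓡 l) ∞ M] in
theorem derivAlong_mfderiv (hf : ContMDiff (𝓡 l) (𝓡 m) ∞ f) (x : M)
    (Y : Π y : M, TangentSpace (𝓡 l) y) (v : TangentSpace (𝓡 l) x) :
    derivAlong D f (fun y ↦ mfderiv (𝓡 l) (𝓡 m) f y (Y y)) x v =
      ∑ i, (mvfderiv (𝓡 l) (pushCoeff f x Y i) x v • coordFrame (f x) i (f x) +
        pushCoeff f x Y i x •
          D (coordFrame (f x) i) (f x) (mfderiv (𝓡 l) (𝓡 m) f x v)) := by
  unfold derivAlong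
  refine Finset.sum_congr rfl fun i _ ↦ ?_
  congr 2
  · congr 1
    refine mvfderiv_congr ?_
    filter_upwards [eventually_mem_chart_source hf x] with y hy
    exact localFrameCoeff_eq_mvfderiv hy i _
  · exact localFrameCoeff_eq_mvfderiv (mem_chart_source _ _) i _

theorem derivAlong_mfderiv_add (hf : ContMDiff (𝓡 l) (𝓡 m) ∞ f) (x : M)
    {Y Z : Π y : M, TangentSpace (𝓡 l) y} (hY : IsSmoothField Y) (hZ : IsSmoothField Z)
    (v : TangentSpace (𝓡 l) x) :
    derivAlong D f (fun y ↦ mfderiv (𝓡 l) (𝓡 m) f y (Y y + Z y)) x v =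
      derivAlong D f (fun y ↦ mfderiv (𝓡 l) (𝓡 m) f y (Y y)) x v +
      derivAlong D f (fun y ↦ mfderiv (𝓡 l) (𝓡 m) f y (Z y)) x v := by
  have e : ∀ i : Fin m, pushCoeff f x (fun y ↦ Y y + Z y) i =
      pushCoeff f x Y i + pushCoeff f x Z i := by
    intro i; ext y; simp [pushCoeff]
  rw [derivAlong_mfderiv D hf x (fun y ↦ Y y + Z y), derivAlong_mfderiv D hf,
    derivAlong_mfderiv D hf, ← Finset.sum_add_distrib]
  refine Finset.sum_congr rfl fun i _ ↦ ?_
  rw [e, mvfderiv_add (mdifferentiableAt_pushCoeff hf x hY i)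
    (mdifferentiableAt_pushCoeff hf x hZ i)]
  simp only [add_apply, Pi.add_apply, add_smul]
  abel

theorem derivAlong_mfderiv_smul (hf : ContMDiff (𝓡 l) (𝓡 m) ∞ f) (x : M) (c : ℝ)
    {Y : Π y : M, TangentSpace (𝓡 l) y} (hY : IsSmoothField Y) (v : TangentSpace (𝓡 l) x) :
    derivAlong D f (fun y ↦ mfderiv (𝓡 l) (𝓡 m) f y (c • Y y)) x v =
      c • derivAlong D f (fun y ↦ mfderiv (𝓡 l) (𝓡 m) f y (Y y)) x v := by
  have e : ∀ i : Fin m, pushCoeff f x (fun y ↦ c • Y y) i = (fun _ ↦ c) * pushCoeff f x Y i := by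
    intro i; ext y; simp [pushCoeff]
  rw [derivAlong_mfderiv D hf x (fun y ↦ c • Y y), derivAlong_mfderiv D hf, Finset.smul_sum]
  refine Finset.sum_congr rfl fun i _ ↦ ?_
  rw [e, mvfderiv_mul mdifferentiableAt_const (mdifferentiableAt_pushCoeff hf x hY i),
    mvfderiv_const]
  simp [smul_smul]

omit [IsManifold (𝓡 l) ∞ M] in
theorem derivAlong_add_right (hf : ContMDiff (𝓡 l) (𝓡 m) ∞ f) (x : M)
    (Y : Π y : M, TangentSpace (𝓡 l) y) (v w : TangentSpace (𝓡 l) x) :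
    derivAlong D f (fun y ↦ mfderiv (𝓡 l) (𝓡 m) f y (Y y)) x (v + w) =
      derivAlong D f (fun y ↦ mfderiv (𝓡 l) (𝓡 m) f y (Y y)) x v +
      derivAlong D f (fun y ↦ mfderiv (𝓡 l) (𝓡 m) f y (Y y)) x w := by
  rw [derivAlong_mfderiv D hf, derivAlong_mfderiv D hf, derivAlong_mfderiv D hf,
    ← Finset.sum_add_distrib]
  refine Finset.sum_congr rfl fun i _ ↦ ?_
  simp only [map_add, add_smul, smul_add]
  abel

/-- `D_X (df Y) - D_Y (df X) = df [X, Y]` for a torsion-free connection `D`. -/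
theorem derivAlong_sub_derivAlong (hD : D.torsion = 0) (hf : ContMDiff (𝓡 l) (𝓡 m) ∞ f) (x : M)
    {X Y : Π y : M, TangentSpace (𝓡 l) y} (hX : IsSmoothField X) (hY : IsSmoothField Y) :
    derivAlong D f (fun y ↦ mfderiv (𝓡 l) (𝓡 m) f y (Y y)) x (X x) -
      derivAlong D f (fun y ↦ mfderiv (𝓡 l) (𝓡 m) f y (X y)) x (Y x) =
    mfderiv (𝓡 l) (𝓡 m) f x (mlieBracket (𝓡 l) X Y x) := by
  have hp := mem_chart_source (EuclideanSpace ℝ (Fin m)) (f x)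
  rw [derivAlong_mfderiv D hf, derivAlong_mfderiv D hf, Finset.sum_add_distrib,
    Finset.sum_add_distrib, add_sub_add_comm, ← Finset.sum_sub_distrib]
  -- The coefficient derivatives give `X(Y(φ_i ∘ f)) - Y(X(φ_i ∘ f)) = [X, Y](φ_i ∘ f)`.
  have h1 : ∑ i, (mvfderiv (𝓡 l) (pushCoeff f x Y i) x (X x) • coordFrame (f x) i (f x) -
      mvfderiv (𝓡 l) (pushCoeff f x X i) x (Y x) • coordFrame (f x) i (f x)) =
      mfderiv (𝓡 l) (𝓡 m) f x (mlieBracket (𝓡 l) X Y x) := by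
    rw [← sum_mvfderiv_coordFun_smul hp (mfderiv (𝓡 l) (𝓡 m) f x (mlieBracket (𝓡 l) X Y x))]
    refine Finset.sum_congr rfl fun i _ ↦ ?_
    rw [← sub_smul]
    congr 1
    rw [mvfderiv_congr (pushCoeff_eq_mvfderiv_comp hf x Y i),
      mvfderiv_congr (pushCoeff_eq_mvfderiv_comp hf x X i),
      mvfderiv_mlieBracket ((contMDiffAt_coordFun hp i).comp x (hf x))
        (hX.mdifferentiableAt (by simp)) (hY.mdifferentiableAt (by simp))]
    exact mvfderiv_comp_apply x ((contMDiffAt_coordFun hp i).mdifferentiableAt (by simp))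
      (hf.mdifferentiableAt (by simp)) _
  -- Symmetry of the Christoffel symbols: zero torsion and commuting frame fields. It makes the
  -- remaining double sums cancel.
  have h2 : ∀ i j, D (coordFrame (f x) i) (f x) (coordFrame (f x) j (f x)) =
      D (coordFrame (f x) j) (f x) (coordFrame (f x) i (f x)) := by
    intro i j
    have := D.torsion_eq_zero_iff.1 hD
      ((contMDiffAt_coordFrame hp j).mdifferentiableAt (by simp))
      ((contMDiffAt_coordFrame hp i).mdifferentiableAt (by simp))
    rwa [mlieBracket_coordFrame, sub_eq_zero] at this
  have h3 : ∀ W Z : Π y : M, TangentSpace (𝓡 l) y,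
      ∑ i, pushCoeff f x W i x • D (coordFrame (f x) i) (f x) (mfderiv (𝓡 l) (𝓡 m) f x (Z x)) =
      ∑ i, ∑ j, (pushCoeff f x W i x * pushCoeff f x Z j x) •
        D (coordFrame (f x) i) (f x) (coordFrame (f x) j (f x)) := by
    intro W Z
    refine Finset.sum_congr rfl fun i _ ↦ ?_
    rw [(sum_pushCoeff_smul hf x Z).self_of_nhds, map_sum, Finset.smul_sum]
    refine Finset.sum_congr rfl fun j _ ↦ ?_
    rw [map_smul, smul_smul]
  rw [h1, h3 Y X, h3 X Y, Finset.sum_comm, add_eq_left, sub_eq_zero]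
  refine Finset.sum_congr rfl fun i _ ↦ Finset.sum_congr rfl fun j _ ↦ ?_
  rw [h2, mul_comm]

/-- `X (g(df Y, df Z)) = g(D_X (df Y), df Z) + g(df Y, D_X (df Z))` for the Levi-Civita
connection `D` of `g`. -/
theorem mvfderiv_metric {g : LorentzianMetric m N} (hD : IsLeviCivita g D)
    (hf : ContMDiff (𝓡 l) (𝓡 m) ∞ f) (x : M)
    {Y Z : Π y : M, TangentSpace (𝓡 l) y} (hY : IsSmoothField Y) (hZ : IsSmoothField Z)
    (v : TangentSpace (𝓡 l) x) :
    mvfderiv (𝓡 l) (fun y ↦ g.val (f y) (mfderiv (𝓡 l) (𝓡 m) f y (Y y))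
      (mfderiv (𝓡 l) (𝓡 m) f y (Z y))) x v =
    g.val (f x) (derivAlong D f (fun y ↦ mfderiv (𝓡 l) (𝓡 m) f y (Y y)) x v)
      (mfderiv (𝓡 l) (𝓡 m) f x (Z x)) +
    g.val (f x) (mfderiv (𝓡 l) (𝓡 m) f x (Y x))
      (derivAlong D f (fun y ↦ mfderiv (𝓡 l) (𝓡 m) f y (Z y)) x v) := by
  have hp := mem_chart_source (EuclideanSpace ℝ (Fin m)) (f x)
  let e : Fin m → Π q : N, TangentSpace (𝓡 m) q := coordFrame (f x)
  let G : Fin m → Fin m → N → ℝ := fun i j q ↦ g.val q (e i q) (e j q)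
  have he : ∀ i, ContMDiffAt (𝓡 m) (𝓡 m).tangent ∞
      (fun q ↦ (⟨q, e i q⟩ : TangentBundle (𝓡 m) N)) (f x) :=
    fun i ↦ contMDiffAt_coordFrame hp i
  have hG : ∀ i j, MDifferentiableAt (𝓡 m) 𝓘(ℝ, ℝ) (G i j) (f x) := by
    intro i j
    have h := ContMDiffAt.clm_bundle_apply₂ (E₃ := fun _ : N ↦ ℝ) (b := fun q : N ↦ q)
      (g.contMDiff (f x)) (he i) (he j)
    exact ((contMDiffAt_section _).1 h).mdifferentiableAt (by simp)
  have hfx : MDifferentiableAt (𝓡 l) (𝓡 m) f x := hf.mdifferentiableAt (by simp)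
  have hYi : ∀ i : Fin m, MDifferentiableAt (𝓡 l) 𝓘(ℝ, ℝ) (pushCoeff f x Y i) x :=
    mdifferentiableAt_pushCoeff hf x hY
  have hZi : ∀ i : Fin m, MDifferentiableAt (𝓡 l) 𝓘(ℝ, ℝ) (pushCoeff f x Z i) x :=
    mdifferentiableAt_pushCoeff hf x hZ
  have hGf : ∀ i j, MDifferentiableAt (𝓡 l) 𝓘(ℝ, ℝ) (G i j ∘ f) x :=
    fun i j ↦ (hG i j).comp x hfx
  have expand : (fun y ↦ g.val (f y) (mfderiv (𝓡 l) (𝓡 m) f y (Y y))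
      (mfderiv (𝓡 l) (𝓡 m) f y (Z y))) =ᶠ[𝓝 x]
      fun y ↦ ∑ i, ∑ j, (pushCoeff f x Y i * pushCoeff f x Z j * (G i j ∘ f)) y := by
    filter_upwards [sum_pushCoeff_smul hf x Y, sum_pushCoeff_smul hf x Z] with y h1 h2
    rw [h1, h2, map_sum (g.val (f y))]
    simp only [sum_apply]
    refine Finset.sum_congr rfl fun i _ ↦ ?_
    rw [map_sum]
    refine Finset.sum_congr rfl fun j _ ↦ ?_
    simp only [map_smul, smul_apply, smul_eq_mul, Pi.mul_apply, Function.comp, G, e]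
    ring
  let w := mfderiv (𝓡 l) (𝓡 m) f x v
  -- Compatibility of `D` with `g` is used only on frame fields; the rest is the product rule for `∑
  -- Yⁱ Zʲ (G i j ∘ f)`.
  have dG : ∀ i j, mvfderiv (𝓡 l) (G i j ∘ f) x v =
      g.val (f x) (D (e i) (f x) w) (e j (f x)) + g.val (f x) (e i (f x)) (D (e j) (f x) w) :=
    fun i j ↦ (mvfderiv_comp_apply x (hG i j) hfx v).trans
      (hD.metric (e i) (e j) (f x) ((he i).mdifferentiableAt (by simp))
        ((he j).mdifferentiableAt (by simp)) w)
  have r1 : g.val (f x) (derivAlong D f (fun y ↦ mfderiv (𝓡 l) (𝓡 m) f y (Y y)) x v)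
      (mfderiv (𝓡 l) (𝓡 m) f x (Z x)) = ∑ i, ∑ j,
        (mvfderiv (𝓡 l) (pushCoeff f x Y i) x v * G i j (f x) +
          pushCoeff f x Y i x * g.val (f x) (D (e i) (f x) w) (e j (f x))) *
        pushCoeff f x Z j x := by
    rw [derivAlong_mfderiv D hf, (sum_pushCoeff_smul hf x Z).self_of_nhds, map_sum (g.val (f x))]
    simp only [sum_apply]
    refine Finset.sum_congr rfl fun i _ ↦ ?_
    rw [map_sum]
    refine Finset.sum_congr rfl fun j _ ↦ ?_
    simp only [map_smul, map_add, add_apply, smul_apply, smul_eq_mul]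
    ring
  have r2 : g.val (f x) (mfderiv (𝓡 l) (𝓡 m) f x (Y x))
      (derivAlong D f (fun y ↦ mfderiv (𝓡 l) (𝓡 m) f y (Z y)) x v) = ∑ i, ∑ j,
        pushCoeff f x Y i x * (mvfderiv (𝓡 l) (pushCoeff f x Z j) x v * G i j (f x) +
          pushCoeff f x Z j x * g.val (f x) (e i (f x)) (D (e j) (f x) w)) := by
    rw [derivAlong_mfderiv D hf, (sum_pushCoeff_smul hf x Y).self_of_nhds, map_sum (g.val (f x))]
    simp only [sum_apply]
    refine Finset.sum_congr rfl fun i _ ↦ ?_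
    rw [map_sum]
    refine Finset.sum_congr rfl fun j _ ↦ ?_
    simp only [map_smul, map_add, smul_apply, smul_eq_mul]
    ring
  have hterm : ∀ i j, MDifferentiableAt (𝓡 l) 𝓘(ℝ, ℝ)
      (pushCoeff f x Y i * pushCoeff f x Z j * (G i j ∘ f)) x :=
    fun i j ↦ ((hYi i).mul (hZi j)).mul (hGf i j)
  have hsum : ∀ i, MDifferentiableAt (𝓡 l) 𝓘(ℝ, ℝ)
      (fun y ↦ ∑ j, (pushCoeff f x Y i * pushCoeff f x Z j * (G i j ∘ f)) y) x := by
    intro i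
    have := MDifferentiableAt.sum (t := Finset.univ) fun j _ ↦ hterm i j
    convert this using 1
    ext y
    simp
  rw [mvfderiv_congr expand, mvfderiv_sum_apply _ fun i _ ↦ hsum i, r1, r2,
    ← Finset.sum_add_distrib]
  refine Finset.sum_congr rfl fun i _ ↦ ?_
  rw [mvfderiv_sum_apply _ fun j _ ↦ hterm i j, ← Finset.sum_add_distrib]
  refine Finset.sum_congr rfl fun j _ ↦ ?_
  rw [mvfderiv_mul ((hYi i).mul (hZi j)) (hGf i j), mvfderiv_mul (hYi i) (hZi j)]
  simp only [add_apply, smul_apply, smul_eq_mul, Pi.mul_apply, dG, Function.comp]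
  ring

end DerivAlong

/-! ### Diagonalisation and spectral projections as polynomials. -/

section LinearAlgebra

variable {V : Type*} [AddCommGroup V] [Module ℝ V]

/-- Spectral theorem for an endomorphism which is symmetric for a positive definite form. -/
theorem iSup_eigenspace_eq_top_of_posDef [FiniteDimensional ℝ V] (B : V →ₗ[ℝ] V →ₗ[ℝ] ℝ)
    (hsymm : ∀ v w, B v w = B w v) (hpos : ∀ v, v ≠ 0 → 0 < B v v) (T : Module.End ℝ V)
    (hT : ∀ v w, B (T v) w = B v (T w)) : ⨆ r, T.eigenspace r = ⊤ := by
  let core : InnerProductSpace.Core ℝ V :=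
    { inner := fun v w ↦ B v w
      conj_inner_symm := fun v w ↦ by simpa using hsymm w v
      re_inner_nonneg := fun v ↦ by
        rcases eq_or_ne v 0 with rfl | hv
        · simp
        · simpa using (hpos v hv).le
      add_left := fun u v w ↦ by simp
      smul_left := fun u v c ↦ by simp
      definite := fun v hv ↦ by
        by_contra hne
        exact (hpos v hne).ne' hv }
  let _ : NormedAddCommGroup V := core.toNormedAddCommGroup
  let _ : InnerProductSpace ℝ V := InnerProductSpace.ofCore core.toCore
  have hsym : LinearMap.IsSymmetric (T : V →ₗ[ℝ] V) := fun v w ↦ hT v w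
  exact (Submodule.orthogonal_eq_bot_iff).1 hsym.orthogonalComplement_iSup_eigenspaces_eq_bot

variable {k : ℕ} {c : Fin (k + 1) → ℝ} {T : Module.End ℝ V}

/-- The projection on the eigenspace for `c α` as a polynomial in the endomorphism. -/
def eigenprojPoly (c : Fin (k + 1) → ℝ) (α : Fin (k + 1)) : Polynomial ℝ :=
  Lagrange.basis Finset.univ c α

theorem sum_aeval_eigenprojPoly (hc : Function.Injective c) (v : V) :
    ∑ α, Polynomial.aeval T (eigenprojPoly c α) v = v := by
  have h := congrArg (fun p ↦ Polynomial.aeval T p v)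
    (Lagrange.sum_basis (s := Finset.univ) (v := c) hc.injOn Finset.univ_nonempty)
  simpa [eigenprojPoly] using h

theorem aeval_apply_of_mem_eigenspace {r : ℝ} {v : V} (hv : v ∈ T.eigenspace r)
    (p : Polynomial ℝ) : Polynomial.aeval T p v = p.eval r • v := by
  rcases eq_or_ne v 0 with rfl | hne
  · simp
  · exact Module.End.aeval_apply_of_hasEigenvector ⟨hv, hne⟩

theorem aeval_eigenprojPoly_of_mem (hc : Function.Injective c) {α : Fin (k + 1)} {v : V}
    (hv : v ∈ T.eigenspace (c α)) : Polynomial.aeval T (eigenprojPoly c α) v = v := by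
  rw [aeval_apply_of_mem_eigenspace hv, eigenprojPoly,
    Lagrange.eval_basis_self hc.injOn (Finset.mem_univ α), one_smul]

/-- The Lagrange polynomial is `1` at `c α` and `0` at the other `c β`, so it acts on each
eigenspace as the identity or zero; since the eigenspaces span, this decides its range. -/
theorem aeval_eigenprojPoly_mem (hc : Function.Injective c)
    (htop : ⨆ α, T.eigenspace (c α) = ⊤) (α : Fin (k + 1)) (v : V) :
    Polynomial.aeval T (eigenprojPoly c α) v ∈ T.eigenspace (c α) := by
  have hv : v ∈ ⨆ α, T.eigenspace (c α) := htop ▸ Submodule.mem_top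
  induction hv using Submodule.iSup_induction' with
  | mem β w hw =>
    rcases eq_or_ne α β with rfl | hne
    · rwa [aeval_eigenprojPoly_of_mem hc hw]
    · rw [aeval_apply_of_mem_eigenspace hw, eigenprojPoly,
        Lagrange.eval_basis_of_ne hne (Finset.mem_univ β), zero_smul]
      exact Submodule.zero_mem _
  | zero => simp
  | add u w _ _ hu hw => rw [map_add]; exact Submodule.add_mem _ hu hw

end LinearAlgebra

/-! ### Positivity of `g + η ⊗ η` and diagonalisability of `S`. -/

namespace LightlikeHypersurface

variable {n : ℕ} {Mbar : Type*} [TopologicalSpace Mbar]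
  [ChartedSpace (EuclideanSpace ℝ (Fin (n + 2))) Mbar] [IsManifold (𝓡 (n + 2)) ∞ Mbar]
  {M : Type*} [TopologicalSpace M]
  [ChartedSpace (EuclideanSpace ℝ (Fin (n + 1))) M] [IsManifold (𝓡 (n + 1)) ∞ M]
  {gbar : LorentzianMetric (n + 2) Mbar} (F : LightlikeHypersurface M gbar)

/-- The induced metric as a bilinear form. -/
def metricForm (x : M) :
    TangentSpace (𝓡 (n + 1)) x →ₗ[ℝ] TangentSpace (𝓡 (n + 1)) x →ₗ[ℝ] ℝ :=
  LinearMap.mk₂ ℝ (F.metric x) (fun u v w ↦ by simp [metric, inducedMetric])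
    (fun r v w ↦ by simp [metric, inducedMetric]) (fun u v w ↦ by simp [metric, inducedMetric])
    (fun r v w ↦ by simp [metric, inducedMetric])

theorem metric_eq_metricForm (x : M) (v w : TangentSpace (𝓡 (n + 1)) x) :
    F.metric x v w = F.metricForm x v w := rfl

theorem metric_comm (x : M) (v w : TangentSpace (𝓡 (n + 1)) x) :
    F.metric x v w = F.metric x w v := gbar.symm _ _ _

theorem metric_eq_zero_of_mem_rad {x : M} {v : TangentSpace (𝓡 (n + 1)) x} (hv : v ∈ F.rad x)
    (w : TangentSpace (𝓡 (n + 1)) x) : F.metric x v w = 0 := hv w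

/-- The form `g + η ⊗ η` as a bilinear form. -/
def flatForm (x : M) :
    TangentSpace (𝓡 (n + 1)) x →ₗ[ℝ] TangentSpace (𝓡 (n + 1)) x →ₗ[ℝ] ℝ :=
  LinearMap.mk₂ ℝ (F.flat x) (fun u v w ↦ by simp [flat, metric, inducedMetric, η]; ring)
    (fun r v w ↦ by simp [flat, metric, inducedMetric, η]; ring)
    (fun u v w ↦ by simp [flat, metric, inducedMetric, η]; ring)
    (fun r v w ↦ by simp [flat, metric, inducedMetric, η]; ring)

theorem η_add (x : M) (v w : TangentSpace (𝓡 (n + 1)) x) :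
    F.η x (v + w) = F.η x v + F.η x w := by simp [η]

theorem η_smul (x : M) (r : ℝ) (v : TangentSpace (𝓡 (n + 1)) x) :
    F.η x (r • v) = r * F.η x v := by simp [η]

theorem η_ξ (x : M) : F.η x (F.ξ x) = 1 := (F.transversal_spec x).1

theorem η_eq_zero_of_mem_screen {x : M} {w : TangentSpace (𝓡 (n + 1)) x} (hw : w ∈ F.screen x) :
    F.η x w = 0 := (F.transversal_spec x).2.2 w hw

/-- The induced metric is positive semidefinite, and its isotropic vectors are radical. -/
theorem metric_self_nonneg (x : M) (v : TangentSpace (𝓡 (n + 1)) x) :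
    0 ≤ F.metric x v v ∧ (F.metric x v v = 0 → ∃ r : ℝ, v = r • F.ξ x) := by
  obtain ⟨u, hu, hpos⟩ := gbar.lorentzian (F.toFun x)
  have hξ : ∀ w, gbar.val (F.toFun x) (F.d x (F.ξ x)) (F.d x w) = 0 := F.ξ_mem_rad x
  have hne : F.d x (F.ξ x) ≠ 0 := by
    intro h
    exact F.ξ_ne_zero x (F.injective_mfderiv x (h.trans (map_zero (F.d x)).symm))
  -- A nonzero null vector cannot be orthogonal to a timelike one.
  have hue : gbar.val (F.toFun x) u (F.d x (F.ξ x)) ≠ 0 := by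
    intro h
    exact (hpos _ h hne).ne' (hξ _)
  -- Chosen so that `v - r • ξ` is orthogonal to the timelike `u`, where the ambient metric is
  -- positive definite. Subtracting a radical vector does not change `g(v, v)`.
  let r := gbar.val (F.toFun x) u (F.d x v) / gbar.val (F.toFun x) u (F.d x (F.ξ x))
  have horth : gbar.val (F.toFun x) u (F.d x (v - r • F.ξ x)) = 0 := by
    simp only [map_sub, map_smul, smul_eq_mul, r]
    field_simp
    ring
  have hsq : gbar.val (F.toFun x) (F.d x (v - r • F.ξ x)) (F.d x (v - r • F.ξ x)) =
      F.metric x v v := by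
    have h1 := hξ v
    have h2 := hξ (F.ξ x)
    have h3 := gbar.symm (F.toFun x) (F.d x v) (F.d x (F.ξ x))
    rw [h1] at h3
    simp only [map_sub, map_smul, sub_apply, smul_apply, smul_eq_mul, h1, h2, h3, metric,
      inducedMetric, mul_zero, sub_zero]
  by_cases hz : F.d x (v - r • F.ξ x) = 0
  · refine ⟨?_, fun _ ↦ ⟨r, ?_⟩⟩
    · rw [← hsq, hz]; simp
    · exact sub_eq_zero.1 (F.injective_mfderiv x (hz.trans (map_zero (F.d x)).symm))
  · have := hpos _ horth hz
    rw [hsq] at this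
    exact ⟨this.le, fun h ↦ absurd h this.ne'⟩

theorem flat_self_pos (x : M) {v : TangentSpace (𝓡 (n + 1)) x} (hv : v ≠ 0) :
    0 < F.flat x v v := by
  obtain ⟨h0, h1⟩ := F.metric_self_nonneg x v
  have hη := mul_self_nonneg (F.η x v)
  unfold flat
  refine lt_of_le_of_ne (add_nonneg h0 hη) fun h ↦ hv ?_
  obtain ⟨r, rfl⟩ := h1 (by linarith)
  have hz : F.η x (r • F.ξ x) * F.η x (r • F.ξ x) = 0 := by linarith
  rw [mul_self_eq_zero, η_smul, η_ξ, mul_one] at hz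
  rw [hz, zero_smul]

theorem screenProj_mem (x : M) (v : TangentSpace (𝓡 (n + 1)) x) :
    F.screenProj x v ∈ F.screen x := Submodule.projection_apply_mem _ _

theorem sub_screenProj_mem (x : M) (v : TangentSpace (𝓡 (n + 1)) x) :
    v - F.screenProj x v ∈ F.rad x := Submodule.sub_projection_mem _ _

theorem eq_screenProj_add_η_smul_ξ (x : M) (v : TangentSpace (𝓡 (n + 1)) x) :
    v = F.screenProj x v + F.η x v • F.ξ x := by
  have h := F.sub_screenProj_mem x v
  unfold rad at h
  rw [F.radical_eq_span] at h
  obtain ⟨r, hr⟩ := Submodule.mem_span_singleton.1 h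
  have e : v = F.screenProj x v + r • F.ξ x := by rw [hr]; abel
  have hη := congrArg (F.η x) e
  rw [η_add, η_smul, η_ξ, F.η_eq_zero_of_mem_screen (F.screenProj_mem x v)] at hη
  rw [hη]
  simpa using e

variable {F} {Dbar : AffineConnection (n + 2) Mbar}
  {S : Π x : M, TangentSpace (𝓡 (n + 1)) x →L[ℝ] TangentSpace (𝓡 (n + 1)) x}

/-- Commuting with `P`, `S` preserves both the screen and the line of `ξ`. Hence `η ∘ S = η(Sξ) η`,
and `η ⊗ η` is `S`-symmetric along with `g`. -/
theorem IsATensor.flat_symmetric (hS : F.IsATensor Dbar S) (x : M)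
    (v w : TangentSpace (𝓡 (n + 1)) x) : F.flat x (S x v) w = F.flat x v (S x w) := by
  have hξ : F.screenProj x (F.ξ x) = 0 :=
    (Submodule.projection_apply_eq_zero_iff _).2 (F.ξ_mem_rad x)
  have hSξ : S x (F.ξ x) = F.η x (S x (F.ξ x)) • F.ξ x := by
    have := F.eq_screenProj_add_η_smul_ξ x (S x (F.ξ x))
    rwa [hS.screen_preserving, hξ, map_zero, zero_add] at this
  have key : ∀ u, F.η x (S x u) = F.η x u * F.η x (S x (F.ξ x)) := by
    intro u
    have h := congrArg (fun z ↦ F.η x (S x z)) (F.eq_screenProj_add_η_smul_ξ x u)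
    simp only [map_add, map_smul, η_add, η_smul] at h
    rw [← hS.screen_preserving, F.η_eq_zero_of_mem_screen (F.screenProj_mem x _), zero_add] at h
    exact h
  unfold flat
  rw [hS.symmetric, key v, key w]
  ring

/-- Symmetry for the degenerate `g` alone would not give diagonalisability; the spectral theorem is
applied to `g + η ⊗ η`. -/
theorem IsATensor.iSup_eigenspace (hS : F.IsATensor Dbar S) (x : M) :
    ⨆ r, Module.End.eigenspace
      (S x : TangentSpace (𝓡 (n + 1)) x →ₗ[ℝ] TangentSpace (𝓡 (n + 1)) x) r = ⊤ := by
  have : FiniteDimensional ℝ (TangentSpace (𝓡 (n + 1)) x) :=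
    inferInstanceAs (FiniteDimensional ℝ (EuclideanSpace ℝ (Fin (n + 1))))
  refine iSup_eigenspace_eq_top_of_posDef (F.flatForm x) (fun v w ↦ ?_)
    (fun v hv ↦ F.flat_self_pos x hv) _ (fun v w ↦ hS.flat_symmetric x v w)
  change F.flat x v w = F.flat x w v
  unfold flat
  rw [F.metric_comm]
  ring

theorem IsATensor.iSup_eigendistribution (hS : F.IsATensor Dbar S) {k : ℕ} {c : Fin (k + 1) → ℝ}
    (hc : HasConstantEigenvalues S c) (x : M) : ⨆ α, eigendistribution S (c α) x = ⊤ := by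
  rw [← top_le_iff, ← hS.iSup_eigenspace x]
  refine iSup_le fun r ↦ ?_
  by_cases h : Module.End.HasEigenvalue
      (S x : TangentSpace (𝓡 (n + 1)) x →ₗ[ℝ] TangentSpace (𝓡 (n + 1)) x) r
  · obtain ⟨α, rfl⟩ := (hc.hasEigenvalue_iff x r).1 h
    exact le_iSup (fun α ↦ eigendistribution S (c α) x) α
  · rw [Module.End.hasEigenvalue_iff, not_not] at h
    rw [h]
    exact bot_le

end LightlikeHypersurface

/-! ### Smooth vector fields: algebra, extension of vectors, polynomials in `S`. -/

section SmoothFields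

open scoped Topology

variable {m : ℕ} {M : Type*} [TopologicalSpace M] [ChartedSpace (EuclideanSpace ℝ (Fin m)) M]
  [IsManifold (𝓡 m) ∞ M] {X Y : Π x : M, TangentSpace (𝓡 m) x}

theorem IsSmoothField.add (hX : IsSmoothField X) (hY : IsSmoothField Y) :
    IsSmoothField (fun x ↦ X x + Y x) := ContMDiff.add_section hX hY

theorem IsSmoothField.const_smul (r : ℝ) (hX : IsSmoothField X) :
    IsSmoothField (fun x ↦ r • X x) := ContMDiff.const_smul_section hX

theorem isSmoothField_zero : IsSmoothField (fun x : M ↦ (0 : TangentSpace (𝓡 m) x)) :=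
  contMDiff_zeroSection ℝ _

theorem IsSmoothField.sum {ι : Type*} (s : Finset ι) {Z : ι → Π x : M, TangentSpace (𝓡 m) x}
    (hZ : ∀ i, IsSmoothField (Z i)) : IsSmoothField (fun x ↦ ∑ i ∈ s, Z i x) := by
  classical
  induction s using Finset.induction_on with
  | empty => simpa using isSmoothField_zero
  | insert i s hi ih => simpa only [Finset.sum_insert hi] using (hZ i).add ih

/-- Every tangent vector is a value of a smooth vector field. -/
theorem exists_isSmoothField [T2Space M] (x : M) (v : TangentSpace (𝓡 m) x) :
    ∃ X : Π x : M, TangentSpace (𝓡 m) x, IsSmoothField X ∧ X x = v := by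
  let E := EuclideanSpace ℝ (Fin m)
  let Z : Π y : M, TangentSpace (𝓡 m) y := FiberBundle.extend E v
  obtain ⟨s, hs, hZ⟩ := FiberBundle.exists_contMDiffOn_extend (k := ∞) (𝓡 m) E v
  -- A bump function equal to `1` at `x` makes a local extension of `v` global.
  obtain ⟨ψ, -, hψ⟩ := (SmoothBumpFunction.nhds_basis_tsupport (I := 𝓡 m) x).mem_iff.1
    (interior_mem_nhds.2 hs)
  refine ⟨(ψ : M → ℝ) • Z, ContMDiffOn.smul_section_of_tsupport ψ.contMDiff.contMDiffOn
    isOpen_interior hψ (hZ.mono interior_subset), ?_⟩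
  change ψ x • Z x = v
  rw [ψ.eq_one, one_smul]
  exact FiberBundle.extend_apply_self E v

variable {S : Π x : M, TangentSpace (𝓡 m) x →L[ℝ] TangentSpace (𝓡 m) x}

/-- The endomorphism of a tangent space given by an endomorphism field. -/
def endAt (S : Π x : M, TangentSpace (𝓡 m) x →L[ℝ] TangentSpace (𝓡 m) x) (x : M) :
    Module.End ℝ (TangentSpace (𝓡 m) x) :=
  (S x : TangentSpace (𝓡 m) x →ₗ[ℝ] TangentSpace (𝓡 m) x)

theorem IsSmoothField.apply (hX : IsSmoothField X)
    (hS : ContMDiff (𝓡 m)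
      ((𝓡 m).prod 𝓘(ℝ, EuclideanSpace ℝ (Fin m) →L[ℝ] EuclideanSpace ℝ (Fin m))) ∞
      (fun x ↦ TotalSpace.mk' (EuclideanSpace ℝ (Fin m) →L[ℝ] EuclideanSpace ℝ (Fin m))
        (E := fun x : M ↦ TangentSpace (𝓡 m) x →L[ℝ] TangentSpace (𝓡 m) x) x (S x))) :
    IsSmoothField (fun x ↦ S x (X x)) :=
  ContMDiff.clm_bundle_apply (b := fun x : M ↦ x) hS hX

/-- With constant eigenvalues, one polynomial with constant coefficients serves at every point, so
this yields smoothness of the eigencomponents of a field. -/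
theorem IsSmoothField.aeval (hX : IsSmoothField X)
    (hS : ContMDiff (𝓡 m)
      ((𝓡 m).prod 𝓘(ℝ, EuclideanSpace ℝ (Fin m) →L[ℝ] EuclideanSpace ℝ (Fin m))) ∞
      (fun x ↦ TotalSpace.mk' (EuclideanSpace ℝ (Fin m) →L[ℝ] EuclideanSpace ℝ (Fin m))
        (E := fun x : M ↦ TangentSpace (𝓡 m) x →L[ℝ] TangentSpace (𝓡 m) x) x (S x)))
    (p : Polynomial ℝ) : IsSmoothField (fun x ↦ Polynomial.aeval (endAt S x) p (X x)) := by
  have hpow : ∀ i : ℕ, IsSmoothField (fun x ↦ (endAt S x ^ i) (X x)) := by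
    intro i
    induction i with
    | zero => simpa using hX
    | succ i ih =>
      simp only [pow_succ']
      exact ih.apply hS
  induction p using Polynomial.induction_on' with
  | add p q hp hq =>
    simp only [map_add, LinearMap.add_apply]
    exact hp.add hq
  | monomial i r =>
    simp only [Polynomial.aeval_monomial, ← Algebra.smul_def, LinearMap.smul_apply]
    exact (hpow i).const_smul r

end SmoothFields

/-! ### The induced connection; torsion and metric compatibility in the totally geodesic case. -/

namespace LightlikeHypersurface

variable {n : ℕ} {Mbar : Type*} [TopologicalSpace Mbar]
  [ChartedSpace (EuclideanSpace ℝ (Fin (n + 2))) Mbar] [IsManifold (𝓡 (n + 2)) ∞ Mbar]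
  {M : Type*} [TopologicalSpace M]
  [ChartedSpace (EuclideanSpace ℝ (Fin (n + 1))) M] [IsManifold (𝓡 (n + 1)) ∞ M]
  {gbar : LorentzianMetric (n + 2) Mbar} (F : LightlikeHypersurface M gbar)
  (Dbar : AffineConnection (n + 2) Mbar) {X Y Z : Π x : M, TangentSpace (𝓡 (n + 1)) x}

theorem inducedConnection_add (hY : IsSmoothField Y) (hZ : IsSmoothField Z) (x : M)
    (v : TangentSpace (𝓡 (n + 1)) x) :
    F.inducedConnection Dbar (fun y ↦ Y y + Z y) x v =
      F.inducedConnection Dbar Y x v + F.inducedConnection Dbar Z x v := by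
  unfold inducedConnection ambientDeriv
  rw [← map_add]
  exact congrArg _ (derivAlong_mfderiv_add Dbar F.contMDiff x hY hZ v)

theorem inducedConnection_const_smul (r : ℝ) (hY : IsSmoothField Y) (x : M)
    (v : TangentSpace (𝓡 (n + 1)) x) :
    F.inducedConnection Dbar (fun y ↦ r • Y y) x v = r • F.inducedConnection Dbar Y x v := by
  unfold inducedConnection ambientDeriv
  rw [← map_smul]
  exact congrArg _ (derivAlong_mfderiv_smul Dbar F.contMDiff x r hY v)

theorem inducedConnection_sum {ι : Type*} (s : Finset ι)
    {W : ι → Π x : M, TangentSpace (𝓡 (n + 1)) x} (hW : ∀ i, IsSmoothField (W i)) (x : M)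
    (v : TangentSpace (𝓡 (n + 1)) x) :
    F.inducedConnection Dbar (fun y ↦ ∑ i ∈ s, W i y) x v =
      ∑ i ∈ s, F.inducedConnection Dbar (W i) x v := by
  classical
  induction s using Finset.induction_on with
  | empty =>
    simpa using F.inducedConnection_const_smul Dbar 0 isSmoothField_zero x v
  | insert i s hi ih =>
    simp only [Finset.sum_insert hi]
    rw [← ih]
    exact F.inducedConnection_add Dbar (hW i) (IsSmoothField.sum s hW) x v

theorem inducedConnection_add_right (Y : Π x : M, TangentSpace (𝓡 (n + 1)) x) (x : M)
    (v w : TangentSpace (𝓡 (n + 1)) x) :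
    F.inducedConnection Dbar Y x (v + w) =
      F.inducedConnection Dbar Y x v + F.inducedConnection Dbar Y x w := by
  unfold inducedConnection ambientDeriv
  rw [← map_add]
  exact congrArg _ (derivAlong_add_right Dbar F.contMDiff x Y v w)

variable {F Dbar}

theorem IsTotallyGeodesic.d_inducedConnection (hF : F.IsTotallyGeodesic Dbar)
    (hY : IsSmoothField Y) (x : M) (v : TangentSpace (𝓡 (n + 1)) x) :
    F.d x (F.inducedConnection Dbar Y x v) = F.ambientDeriv Dbar Y x v :=
  (sub_eq_zero.1 (hF Y hY x v)).symm

theorem IsTotallyGeodesic.inducedConnection_sub (hF : F.IsTotallyGeodesic Dbar)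
    (hD : Dbar.torsion = 0) (hX : IsSmoothField X) (hY : IsSmoothField Y) (x : M) :
    F.inducedConnection Dbar Y x (X x) - F.inducedConnection Dbar X x (Y x) =
      VectorField.mlieBracket (𝓡 (n + 1)) X Y x := by
  apply F.injective_mfderiv x
  rw [map_sub]
  exact (congrArg₂ _ (hF.d_inducedConnection hY x _) (hF.d_inducedConnection hX x _)).trans
    (derivAlong_sub_derivAlong Dbar hD F.contMDiff x hX hY)

/-- On a general lightlike hypersurface the second fundamental form, paired with tangent vectors,
would add terms. Here `df(∇_X Y)` is the ambient derivative, so compatibility is inherited. -/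
theorem IsTotallyGeodesic.mvfderiv_metric (hF : F.IsTotallyGeodesic Dbar)
    (hD : IsLeviCivita gbar Dbar) (hY : IsSmoothField Y) (hZ : IsSmoothField Z) (x : M)
    (v : TangentSpace (𝓡 (n + 1)) x) :
    mvfderiv (𝓡 (n + 1)) (fun y ↦ F.metric y (Y y) (Z y)) x v =
      F.metric x (F.inducedConnection Dbar Y x v) (Z x) +
        F.metric x (Y x) (F.inducedConnection Dbar Z x v) := by
  refine (LightlikeGeometry.mvfderiv_metric Dbar hD F.contMDiff x hY hZ v).trans ?_
  exact congrArg₂ (fun a b ↦ gbar.val _ a (F.d x (Z x)) + gbar.val _ (F.d x (Y x)) b)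
    (hF.d_inducedConnection hY x v).symm (hF.d_inducedConnection hZ x v).symm

end LightlikeHypersurface

/-! ### Vanishing of `g(∇_X Y, Z)` on eigensections, and the radical values of `∇S`. -/

namespace LightlikeHypersurface

variable {n k : ℕ} {Mbar : Type*} [TopologicalSpace Mbar]
  [ChartedSpace (EuclideanSpace ℝ (Fin (n + 2))) Mbar] [IsManifold (𝓡 (n + 2)) ∞ Mbar]
  {M : Type*} [TopologicalSpace M]
  [ChartedSpace (EuclideanSpace ℝ (Fin (n + 1))) M] [IsManifold (𝓡 (n + 1)) ∞ M]
  {gbar : LorentzianMetric (n + 2) Mbar} {F : LightlikeHypersurface M gbar}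
  {Dbar : AffineConnection (n + 2) Mbar}
  {S : Π x : M, TangentSpace (𝓡 (n + 1)) x →L[ℝ] TangentSpace (𝓡 (n + 1)) x}
  {c : Fin (k + 1) → ℝ} {X Y Z : Π x : M, TangentSpace (𝓡 (n + 1)) x}

omit [IsManifold (𝓡 (n + 1)) ∞ M] in
theorem apply_of_mem_eigendistribution {r : ℝ} {x : M} {v : TangentSpace (𝓡 (n + 1)) x}
    (hv : v ∈ eigendistribution S r x) : S x v = r • v := Module.End.mem_eigenspace_iff.1 hv

/-- Eigenvectors for different eigenvalues are orthogonal. -/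
theorem IsATensor.metric_eq_zero (hS : F.IsATensor Dbar S) {a b : ℝ} (hab : a ≠ b) {x : M}
    {v w : TangentSpace (𝓡 (n + 1)) x} (hv : v ∈ eigendistribution S a x)
    (hw : w ∈ eigendistribution S b x) : F.metric x v w = 0 := by
  have h := hS.symmetric x v w
  rw [apply_of_mem_eigendistribution hv, apply_of_mem_eigendistribution hw] at h
  simp only [metric_eq_metricForm, map_smul, LinearMap.smul_apply, smul_eq_mul] at h ⊢
  have : (a - b) * F.metricForm x v w = 0 := by linarith
  exact (mul_eq_zero.1 this).resolve_left (sub_ne_zero.2 hab)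

theorem IsATensor.screenProj_mem_eigendistribution (hS : F.IsATensor Dbar S) {a : ℝ} {x : M}
    {v : TangentSpace (𝓡 (n + 1)) x} (hv : v ∈ eigendistribution S a x) :
    F.screenProj x v ∈ eigendistribution S a x := by
  refine Module.End.mem_eigenspace_iff.2 ?_
  change S x (F.screenProj x v) = _
  rw [← hS.screen_preserving, apply_of_mem_eigendistribution hv, map_smul]

theorem _root_.LightlikeGeometry.IsSectionOf.add
    {D : Π x : M, Submodule ℝ (TangentSpace (𝓡 (n + 1)) x)}
    (hX : IsSectionOf D X) (hY : IsSectionOf D Y) : IsSectionOf D (fun x ↦ X x + Y x) :=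
  ⟨hX.1.add hY.1, fun x ↦ (D x).add_mem (hX.2 x) (hY.2 x)⟩

theorem _root_.LightlikeGeometry.IsSectionOf.const_smul
    {D : Π x : M, Submodule ℝ (TangentSpace (𝓡 (n + 1)) x)}
    (r : ℝ) (hX : IsSectionOf D X) : IsSectionOf D (fun x ↦ r • X x) :=
  ⟨hX.1.const_smul r, fun x ↦ (D x).smul_mem r (hX.2 x)⟩

/-- The component of a vector field in an eigendistribution. -/
def eigenpart (S : Π x : M, TangentSpace (𝓡 (n + 1)) x →L[ℝ] TangentSpace (𝓡 (n + 1)) x)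
    (c : Fin (k + 1) → ℝ) (X : Π x : M, TangentSpace (𝓡 (n + 1)) x) (α : Fin (k + 1)) (x : M) :
    TangentSpace (𝓡 (n + 1)) x :=
  Polynomial.aeval (endAt S x) (eigenprojPoly c α) (X x)

theorem IsATensor.isSectionOf_eigenpart (hS : F.IsATensor Dbar S)
    (hc : HasConstantEigenvalues S c) (hX : IsSmoothField X) (α : Fin (k + 1)) :
    IsSectionOf (eigendistribution S (c α)) (eigenpart S c X α) :=
  ⟨hX.aeval hS.contMDiff _, fun x ↦
    aeval_eigenprojPoly_mem hc.injective (hS.iSup_eigendistribution hc x) α (X x)⟩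

omit [IsManifold (𝓡 (n + 1)) ∞ M] in
theorem sum_eigenpart (hc : HasConstantEigenvalues S c)
    (X : Π x : M, TangentSpace (𝓡 (n + 1)) x) (x : M) : ∑ α, eigenpart S c X α x = X x :=
  sum_aeval_eigenprojPoly hc.injective (X x)

/-- Extend `v` to any smooth field and take its eigencomponent, which at `x` is still `v`. -/
theorem IsATensor.exists_isSectionOf [T2Space M] (hS : F.IsATensor Dbar S)
    (hc : HasConstantEigenvalues S c) {α : Fin (k + 1)} {x : M} {v : TangentSpace (𝓡 (n + 1)) x}
    (hv : v ∈ eigendistribution S (c α) x) :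
    ∃ X, IsSectionOf (eigendistribution S (c α)) X ∧ X x = v := by
  obtain ⟨X, hX, rfl⟩ := exists_isSmoothField x v
  exact ⟨_, hS.isSectionOf_eigenpart hc hX α, aeval_eigenprojPoly_of_mem hc.injective hv⟩

/-- The function `g(∇_X Y, Z)`. -/
def metricDeriv (F : LightlikeHypersurface M gbar) (Dbar : AffineConnection (n + 2) Mbar)
    (X Y Z : Π x : M, TangentSpace (𝓡 (n + 1)) x) (x : M) : ℝ :=
  F.metric x (F.inducedConnection Dbar Y x (X x)) (Z x)

theorem metricDeriv_add_left (X X' Y Z : Π x : M, TangentSpace (𝓡 (n + 1)) x) (x : M) :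
    F.metricDeriv Dbar (fun y ↦ X y + X' y) Y Z x =
      F.metricDeriv Dbar X Y Z x + F.metricDeriv Dbar X' Y Z x := by
  unfold metricDeriv
  rw [inducedConnection_add_right, metric_eq_metricForm, map_add]
  rfl

theorem metricDeriv_add_middle {Y Y' : Π x : M, TangentSpace (𝓡 (n + 1)) x}
    (hY : IsSmoothField Y) (hY' : IsSmoothField Y') (X Z : Π x : M, TangentSpace (𝓡 (n + 1)) x)
    (x : M) : F.metricDeriv Dbar X (fun y ↦ Y y + Y' y) Z x =
      F.metricDeriv Dbar X Y Z x + F.metricDeriv Dbar X Y' Z x := by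
  unfold metricDeriv
  rw [F.inducedConnection_add Dbar hY hY', metric_eq_metricForm, map_add]
  rfl

/-- Differentiate `g(Y, Z) = 0`. -/
theorem IsATensor.metricDeriv_swap (hS : F.IsATensor Dbar S) (hF : F.IsTotallyGeodesic Dbar)
    (hD : IsLeviCivita gbar Dbar) {a b : ℝ} (hab : a ≠ b)
    (hY : IsSectionOf (eigendistribution S a) Y) (hZ : IsSectionOf (eigendistribution S b) Z)
    (X : Π x : M, TangentSpace (𝓡 (n + 1)) x) (x : M) :
    F.metricDeriv Dbar X Y Z x = -F.metricDeriv Dbar X Z Y x := by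
  have h := hF.mvfderiv_metric hD hY.1 hZ.1 x (X x)
  have e : (fun y ↦ F.metric y (Y y) (Z y)) = fun _ ↦ 0 :=
    funext fun y ↦ hS.metric_eq_zero hab (hY.2 y) (hZ.2 y)
  rw [e, mvfderiv_const, F.metric_comm x (Y x)] at h
  simp only [zero_apply] at h
  unfold metricDeriv
  linarith

/-- The difference is `g([X, Y], Z)`, and `[X, Y]` lies in `D_α + D_β`, orthogonal to `D_γ`. The
case `α = β` is allowed and uses integrability of `D_α` alone. -/
theorem IsATensor.metricDeriv_comm (hS : F.IsATensor Dbar S) (hF : F.IsTotallyGeodesic Dbar)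
    (hD : IsLeviCivita gbar Dbar) (hc : HasConstantEigenvalues S c)
    (hint : IsIntegrableAlmostProduct (fun α ↦ eigendistribution S (c α)))
    {α β γ : Fin (k + 1)} (hαγ : α ≠ γ) (hβγ : β ≠ γ)
    (hX : IsSectionOf (eigendistribution S (c α)) X)
    (hY : IsSectionOf (eigendistribution S (c β)) Y)
    (hZ : IsSectionOf (eigendistribution S (c γ)) Z) (x : M) :
    F.metricDeriv Dbar X Y Z x = F.metricDeriv Dbar Y X Z x := by
  have hmem : ∀ {δ : Fin (k + 1)} {W : Π x : M, TangentSpace (𝓡 (n + 1)) x},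
      δ ∈ ({α, β} : Finset (Fin (k + 1))) → IsSectionOf (eigendistribution S (c δ)) W →
      IsSectionOf (fun x ↦ ⨆ δ ∈ ({α, β} : Finset (Fin (k + 1))), eigendistribution S (c δ) x) W :=
    fun {δ W} hδ hW ↦ ⟨hW.1, fun y ↦
      (le_iSup₂ (f := fun δ (_ : δ ∈ ({α, β} : Finset (Fin (k + 1)))) ↦
        eigendistribution S (c δ) y) δ hδ) (hW.2 y)⟩
  have hbr := hint {α, β} X Y (hmem (by simp) hX) (hmem (by simp) hY) x
  have hle : (⨆ δ ∈ ({α, β} : Finset (Fin (k + 1))), eigendistribution S (c δ) x) ≤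
      LinearMap.ker ((F.metricForm x).flip (Z x)) := by
    refine iSup₂_le fun δ hδ v hv ↦ ?_
    have hδγ : δ ≠ γ := by
      rcases Finset.mem_insert.1 hδ with rfl | h
      · exact hαγ
      · rwa [Finset.mem_singleton.1 h]
    exact hS.metric_eq_zero (hc.injective.ne hδγ) hv (hZ.2 x)
  have h0 : F.metricForm x (VectorField.mlieBracket (𝓡 (n + 1)) X Y x) (Z x) = 0 := hle hbr
  rw [← hF.inducedConnection_sub hD.torsion_eq_zero hX.1 hY.1, map_sub, LinearMap.sub_apply,
    sub_eq_zero] at h0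
  exact h0

/-- Three exchanges of the first two arguments, alternating with three sign-changing exchanges of
the last two, reach `T(X, Y, Z) = -T(X, Y, Z)`. -/
theorem IsATensor.metricDeriv_eq_zero_of_distinct (hS : F.IsATensor Dbar S)
    (hF : F.IsTotallyGeodesic Dbar)
    (hD : IsLeviCivita gbar Dbar) (hc : HasConstantEigenvalues S c)
    (hint : IsIntegrableAlmostProduct (fun α ↦ eigendistribution S (c α)))
    {α β γ : Fin (k + 1)} (hαβ : α ≠ β) (hαγ : α ≠ γ) (hβγ : β ≠ γ)
    (hX : IsSectionOf (eigendistribution S (c α)) X)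
    (hY : IsSectionOf (eigendistribution S (c β)) Y)
    (hZ : IsSectionOf (eigendistribution S (c γ)) Z) (x : M) :
    F.metricDeriv Dbar X Y Z x = 0 := by
  have h1 := hS.metricDeriv_comm hF hD hc hint hαγ hβγ hX hY hZ x
  have h2 := hS.metricDeriv_swap hF hD (hc.injective.ne hαγ) hX hZ Y x
  have h3 := hS.metricDeriv_comm hF hD hc hint hαβ.symm hαγ.symm hY hZ hX x
  have h4 := hS.metricDeriv_swap hF hD (hc.injective.ne hαβ.symm) hY hX Z x
  have h5 := hS.metricDeriv_comm hF hD hc hint hβγ.symm hαβ hZ hX hY x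
  have h6 := hS.metricDeriv_swap hF hD (hc.injective.ne hβγ.symm) hZ hY X x
  linarith

/-- `g(∇S(X, Y), Z) = (a - b) g(∇_X Y, Z)` for eigenfields `Y` and `Z`. -/
theorem IsATensor.metric_nablaTensor (hS : F.IsATensor Dbar S) {a b : ℝ}
    (hY : IsSectionOf (eigendistribution S a) Y) {x : M} (hZ : Z x ∈ eigendistribution S b x)
    (X : Π x : M, TangentSpace (𝓡 (n + 1)) x) :
    F.metric x (F.nablaTensor Dbar S X Y x) (Z x) = (a - b) * F.metricDeriv Dbar X Y Z x := by
  have e : (fun y ↦ S y (Y y)) = fun y ↦ a • Y y :=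
    funext fun y ↦ apply_of_mem_eigendistribution (hY.2 y)
  unfold nablaTensor
  rw [e, F.inducedConnection_const_smul Dbar a hY.1, metric_eq_metricForm, map_sub, map_smul,
    LinearMap.sub_apply, LinearMap.smul_apply, ← metric_eq_metricForm, ← metric_eq_metricForm,
    hS.symmetric, apply_of_mem_eigendistribution hZ, metric_eq_metricForm, metric_eq_metricForm,
    map_smul]
  simp only [metricDeriv, metric_eq_metricForm, smul_eq_mul]
  ring

theorem nablaTensor_add (hS : F.IsATensor Dbar S) {Y Y' : Π x : M, TangentSpace (𝓡 (n + 1)) x}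
    (hY : IsSmoothField Y) (hY' : IsSmoothField Y') (X : Π x : M, TangentSpace (𝓡 (n + 1)) x)
    (x : M) : F.nablaTensor Dbar S X (fun y ↦ Y y + Y' y) x =
      F.nablaTensor Dbar S X Y x + F.nablaTensor Dbar S X Y' x := by
  unfold nablaTensor
  simp only [map_add]
  rw [F.inducedConnection_add Dbar (hY.apply hS.contMDiff) (hY'.apply hS.contMDiff),
    F.inducedConnection_add Dbar hY hY', map_add]
  abel

/-- The identity `g(∇S(U, U), U) = 0` for `U = X + Z` with values in the screen at `x`. -/
theorem IsATensor.metricDeriv_add_self (hS : F.IsATensor Dbar S) (hF : F.IsTotallyGeodesic Dbar)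
    (hD : IsLeviCivita gbar Dbar) {a b : ℝ} (hab : a ≠ b)
    (hX : IsSectionOf (eigendistribution S a) X) (hZ : IsSectionOf (eigendistribution S b) Z)
    {x : M} (hXx : X x ∈ F.screen x) (hZx : Z x ∈ F.screen x) :
    F.metricDeriv Dbar X X Z x + F.metricDeriv Dbar Z X Z x = 0 := by
  let U : Π x : M, TangentSpace (𝓡 (n + 1)) x := fun y ↦ X y + Z y
  have h := hS.flat_nabla U (hX.1.add hZ.1) x
  -- Being in the screen at `x` removes the `η` term from `U^♭`, leaving a statement about `g`.
  have hη : F.η x (U x) = 0 :=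
    F.η_eq_zero_of_mem_screen ((F.screen x).add_mem hXx hZx)
  unfold flat at h
  rw [hη, zero_mul, add_zero, F.metric_comm, nablaTensor_add hS hX.1 hZ.1] at h
  have e1 := hS.metric_nablaTensor hX (hX.2 x) U
  have e2 := hS.metric_nablaTensor hX (hZ.2 x) U
  have e3 := hS.metric_nablaTensor hZ (hX.2 x) U
  have e4 := hS.metric_nablaTensor hZ (hZ.2 x) U
  have e5 := hS.metricDeriv_swap hF hD hab hX hZ U x
  have e6 := metricDeriv_add_left (F := F) (Dbar := Dbar) X Z X Z x
  simp only [metric_eq_metricForm, map_add, LinearMap.add_apply] at h e1 e2 e3 e4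
  change F.metricDeriv Dbar U X Z x = _ at e6
  rw [← e6]
  simp only [U, map_add] at h
  -- Of the four terms only the mixed ones survive, `(a - b) T(U, X, Z)` and `(b - a) T(U, Z, X)`;
  -- by skewness they are equal, whence the halves.
  have hz : (a - b) * F.metricDeriv Dbar U X Z x = 0 := by
    simp only [U] at *
    linear_combination (h - e1 - e2 - e3 - e4) / 2 + (a - b) / 2 * e5
  exact (mul_eq_zero.1 hz).resolve_left (sub_ne_zero.2 hab)

/-- `T(X, X, Z)` is quadratic in `X` and `T(Z, X, Z)` linear; comparing the identity for `X` and for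
`X + X` separates them. -/
theorem IsATensor.metricDeriv_self_eq_zero (hS : F.IsATensor Dbar S)
    (hF : F.IsTotallyGeodesic Dbar) (hD : IsLeviCivita gbar Dbar) {a b : ℝ} (hab : a ≠ b)
    (hX : IsSectionOf (eigendistribution S a) X) (hZ : IsSectionOf (eigendistribution S b) Z)
    {x : M} (hXx : X x ∈ F.screen x) (hZx : Z x ∈ F.screen x) :
    F.metricDeriv Dbar X X Z x = 0 := by
  have h1 := hS.metricDeriv_add_self hF hD hab hX hZ hXx hZx
  have h2 := hS.metricDeriv_add_self hF hD hab (hX.add hX) hZ ((F.screen x).add_mem hXx hXx) hZx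
  rw [metricDeriv_add_left, metricDeriv_add_middle hX.1 hX.1,
    metricDeriv_add_middle hX.1 hX.1] at h2
  linarith

/-- Polarisation makes `T` skew in `X, Y`, while integrability of `D_α` makes it symmetric. -/
theorem IsATensor.metricDeriv_eq_zero_of_mem_screen (hS : F.IsATensor Dbar S)
    (hF : F.IsTotallyGeodesic Dbar) (hD : IsLeviCivita gbar Dbar)
    (hc : HasConstantEigenvalues S c)
    (hint : IsIntegrableAlmostProduct (fun α ↦ eigendistribution S (c α)))
    {α γ : Fin (k + 1)} (hαγ : α ≠ γ) (hX : IsSectionOf (eigendistribution S (c α)) X)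
    (hY : IsSectionOf (eigendistribution S (c α)) Y)
    (hZ : IsSectionOf (eigendistribution S (c γ)) Z)
    {x : M} (hXx : X x ∈ F.screen x) (hYx : Y x ∈ F.screen x) (hZx : Z x ∈ F.screen x) :
    F.metricDeriv Dbar X Y Z x = 0 := by
  have hne := hc.injective.ne hαγ
  have h1 := hS.metricDeriv_self_eq_zero hF hD hne hX hZ hXx hZx
  have h2 := hS.metricDeriv_self_eq_zero hF hD hne hY hZ hYx hZx
  have h3 := hS.metricDeriv_self_eq_zero hF hD hne (hX.add hY) hZ
    ((F.screen x).add_mem hXx hYx) hZx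
  rw [metricDeriv_add_left, metricDeriv_add_middle hX.1 hY.1,
    metricDeriv_add_middle hX.1 hY.1] at h3
  have h4 := hS.metricDeriv_comm hF hD hc hint hαγ hαγ hX hY hZ x
  linarith

/-- After the swap the radical vector `Y x` is itself an argument of `g`; no derivative of `Y`
remains. -/
theorem IsATensor.metricDeriv_middle_of_mem_rad (hS : F.IsATensor Dbar S)
    (hF : F.IsTotallyGeodesic Dbar) (hD : IsLeviCivita gbar Dbar) {a b : ℝ} (hab : a ≠ b)
    (hY : IsSectionOf (eigendistribution S a) Y) (hZ : IsSectionOf (eigendistribution S b) Z)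
    (X : Π x : M, TangentSpace (𝓡 (n + 1)) x) {x : M} (hYx : Y x ∈ F.rad x) :
    F.metricDeriv Dbar X Y Z x = 0 := by
  rw [hS.metricDeriv_swap hF hD hab hY hZ X x, metricDeriv, F.metric_comm,
    F.metric_eq_zero_of_mem_rad hYx, neg_zero]

theorem IsATensor.metricDeriv_eq_zero_of_ne [T2Space M] (hS : F.IsATensor Dbar S)
    (hF : F.IsTotallyGeodesic Dbar) (hD : IsLeviCivita gbar Dbar)
    (hc : HasConstantEigenvalues S c)
    (hint : IsIntegrableAlmostProduct (fun α ↦ eigendistribution S (c α)))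
    {α γ : Fin (k + 1)} (hαγ : α ≠ γ) (hX : IsSectionOf (eigendistribution S (c α)) X)
    (hY : IsSectionOf (eigendistribution S (c α)) Y)
    (hZ : IsSectionOf (eigendistribution S (c γ)) Z) (x : M) :
    F.metricDeriv Dbar X Y Z x = 0 := by
  have hne := hc.injective.ne hαγ
  -- The splitting into screen and radical parts is needed only at `x`. Since `P` commutes with `S`,
  -- the screen part of `W x` is an eigenvector and extends to an eigensection.
  have split : ∀ {δ : Fin (k + 1)} {W : Π x : M, TangentSpace (𝓡 (n + 1)) x},
      IsSectionOf (eigendistribution S (c δ)) W →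
      ∃ W₁ W₂, IsSectionOf (eigendistribution S (c δ)) W₁ ∧
        IsSectionOf (eigendistribution S (c δ)) W₂ ∧ W₁ x ∈ F.screen x ∧ W₂ x ∈ F.rad x ∧
        W = fun y ↦ W₁ y + W₂ y := by
    intro δ W hW
    obtain ⟨W₁, hW₁, e⟩ := hS.exists_isSectionOf hc
      (hS.screenProj_mem_eigendistribution (hW.2 x))
    refine ⟨W₁, fun y ↦ W y + (-1 : ℝ) • W₁ y, hW₁, hW.add (hW₁.const_smul (-1)), ?_, ?_, ?_⟩
    · rw [e]; exact F.screenProj_mem x _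
    · change W x + (-1 : ℝ) • W₁ x ∈ F.rad x
      rw [e, neg_one_smul, ← sub_eq_add_neg]; exact F.sub_screenProj_mem x _
    · funext y
      change W y = W₁ y + (W y + (-1 : ℝ) • W₁ y)
      rw [neg_one_smul, add_comm (W y), add_neg_cancel_left]
  obtain ⟨Z₁, Z₂, hZ₁, hZ₂, hZ₁x, hZ₂x, rfl⟩ := split hZ
  obtain ⟨X₁, X₂, hX₁, hX₂, hX₁x, hX₂x, rfl⟩ := split hX
  obtain ⟨Y₁, Y₂, hY₁, hY₂, hY₁x, hY₂x, rfl⟩ := split hY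
  have red : ∀ V W : Π x : M, TangentSpace (𝓡 (n + 1)) x,
      F.metricDeriv Dbar V W (fun y ↦ Z₁ y + Z₂ y) x = F.metricDeriv Dbar V W Z₁ x := by
    intro V W
    have := F.metric_eq_zero_of_mem_rad hZ₂x (F.inducedConnection Dbar W x (V x))
    rw [F.metric_comm] at this
    simp only [metricDeriv, metric_eq_metricForm, map_add] at this ⊢
    rw [this, add_zero]
  -- A radical `Y₂` is removed directly, a radical `X₂` after exchanging it with `Y₁`; only the
  -- screen-valued term remains.
  rw [red, metricDeriv_add_middle hY₁.1 hY₂.1, metricDeriv_add_left,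
    hS.metricDeriv_middle_of_mem_rad hF hD hne hY₂ hZ₁ _ hY₂x,
    hS.metricDeriv_comm hF hD hc hint hαγ hαγ hX₂ hY₁ hZ₁,
    hS.metricDeriv_middle_of_mem_rad hF hD hne hX₂ hZ₁ _ hX₂x,
    hS.metricDeriv_eq_zero_of_mem_screen hF hD hc hint hαγ hX₁ hY₁ hZ₁ hX₁x hY₁x hZ₁x]
  simp

/-- `g(∇_X Y, Z) = 0` for sections `X`, `Y`, `Z` of eigendistributions, those of `Y` and `Z`
being different. -/
theorem IsATensor.metricDeriv_eq_zero [T2Space M] (hS : F.IsATensor Dbar S)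
    (hF : F.IsTotallyGeodesic Dbar) (hD : IsLeviCivita gbar Dbar)
    (hc : HasConstantEigenvalues S c)
    (hint : IsIntegrableAlmostProduct (fun α ↦ eigendistribution S (c α)))
    {α β γ : Fin (k + 1)} (hβγ : β ≠ γ) (hX : IsSectionOf (eigendistribution S (c α)) X)
    (hY : IsSectionOf (eigendistribution S (c β)) Y)
    (hZ : IsSectionOf (eigendistribution S (c γ)) Z) (x : M) :
    F.metricDeriv Dbar X Y Z x = 0 := by
  rcases eq_or_ne α β with rfl | hαβ
  · exact hS.metricDeriv_eq_zero_of_ne hF hD hc hint hβγ hX hY hZ x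
  rcases eq_or_ne α γ with rfl | hαγ
  -- Swapping `Y` and `Z` places the two fields of the same eigendistribution first.
  · rw [hS.metricDeriv_swap hF hD (hc.injective.ne hβγ) hY hZ X x,
      hS.metricDeriv_eq_zero_of_ne hF hD hc hint hβγ.symm hX hZ hY x, neg_zero]
  · exact hS.metricDeriv_eq_zero_of_distinct hF hD hc hint hαβ hαγ hβγ hX hY hZ x

theorem IsATensor.nablaTensor_mem_rad [T2Space M] (hS : F.IsATensor Dbar S)
    (hF : F.IsTotallyGeodesic Dbar) (hD : IsLeviCivita gbar Dbar)
    (hc : HasConstantEigenvalues S c)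
    (hint : IsIntegrableAlmostProduct (fun α ↦ eigendistribution S (c α)))
    (hX : IsSmoothField X) (hY : IsSmoothField Y) (x : M) :
    F.nablaTensor Dbar S X Y x ∈ F.rad x := by
  intro w
  obtain ⟨Z, hZ, rfl⟩ := exists_isSmoothField x w
  change F.metric x (F.nablaTensor Dbar S X Y x) (Z x) = 0
  have secX := hS.isSectionOf_eigenpart hc hX
  have secY := hS.isSectionOf_eigenpart hc hY
  have secZ := hS.isSectionOf_eigenpart hc hZ
  have hYsum : F.nablaTensor Dbar S X Y x =
      ∑ β, F.nablaTensor Dbar S X (eigenpart S c Y β) x := by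
    have e : Y = fun y ↦ ∑ β, eigenpart S c Y β y := funext fun y ↦ (sum_eigenpart hc Y y).symm
    conv_lhs => rw [e]
    unfold nablaTensor
    simp only [map_sum]
    rw [F.inducedConnection_sum Dbar Finset.univ fun β ↦ (secY β).1.apply hS.contMDiff,
      F.inducedConnection_sum Dbar Finset.univ fun β ↦ (secY β).1, map_sum,
      Finset.sum_sub_distrib]
  rw [hYsum, ← sum_eigenpart hc Z x, metric_eq_metricForm, map_sum]
  refine Finset.sum_eq_zero fun γ _ ↦ ?_
  rw [map_sum, LinearMap.sum_apply]
  refine Finset.sum_eq_zero fun β _ ↦ ?_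
  rw [← metric_eq_metricForm, hS.metric_nablaTensor (secY β) ((secZ γ).2 x)]
  rcases eq_or_ne β γ with rfl | hβγ
  · rw [sub_self, zero_mul]
  -- `T` depends on `X` only through the vector `X x`, and additively, so decomposing `X` at the
  -- point suffices.
  have hXsum : F.metricDeriv Dbar X (eigenpart S c Y β) (eigenpart S c Z γ) x =
      ∑ α, F.metricDeriv Dbar (eigenpart S c X α) (eigenpart S c Y β) (eigenpart S c Z γ) x := by
    let L : TangentSpace (𝓡 (n + 1)) x →+ ℝ := AddMonoidHom.mk'
      (fun v ↦ F.metric x (F.inducedConnection Dbar (eigenpart S c Y β) x v)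
        (eigenpart S c Z γ x)) fun u v ↦ by
          rw [inducedConnection_add_right, metric_eq_metricForm, map_add]; rfl
    change L (X x) = ∑ α, L (eigenpart S c X α x)
    rw [← map_sum, sum_eigenpart hc]
  rw [hXsum, Finset.sum_eq_zero fun α _ ↦
    hS.metricDeriv_eq_zero hF hD hc hint hβγ (secX α) (secY β) (secZ γ) x, mul_zero]

end LightlikeHypersurface

end LightlikeGeometry

end

theorem corollary7p3 {n k : ℕ}
    {Mbar : Type*} [TopologicalSpace Mbar] [T2Space Mbar]
    [ChartedSpace (EuclideanSpace ℝ (Fin (n + 2))) Mbar] [IsManifold (𝓡 (n + 2)) ∞ Mbar]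
    {M : Type*} [TopologicalSpace M] [T2Space M]
    [ChartedSpace (EuclideanSpace ℝ (Fin (n + 1))) M] [IsManifold (𝓡 (n + 1)) ∞ M]
    (gbar : LightlikeGeometry.LorentzianMetric (n + 2) Mbar)
    (Dbar : LightlikeGeometry.AffineConnection (n + 2) Mbar)
    (hD : LightlikeGeometry.IsLeviCivita gbar Dbar)
    (F : LightlikeGeometry.LightlikeHypersurface M gbar)
    (hF : F.IsTotallyGeodesic Dbar)
    (S : Π x : M, TangentSpace (𝓡 (n + 1)) x →L[ℝ] TangentSpace (𝓡 (n + 1)) x)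
    (hS : F.IsATensor Dbar S)
    (c : Fin (k + 1) → ℝ)
    (hc : LightlikeGeometry.HasConstantEigenvalues S c)
    (hint : LightlikeGeometry.IsIntegrableAlmostProduct
      (fun α ↦ LightlikeGeometry.eigendistribution S (c α))) :
    F.IsIsotropicATensor Dbar S := by
  exact ⟨hS, fun X Y hX hY x ↦ hS.nablaTensor_mem_rad hF hD hc hint hX hY x⟩
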